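/- Let $a<b$, and let $f,g\in C^\infty([a,b])$ (real-valued, smooth up to the endpoints) satisfy $f\le g$ on $[a,b]$ and $f^{(k)}(a)=g^{(k)}(a)$, $f^{(k)}(b)=g^{(k)}(b)$ for all integers $k\ge 0$. The set $L=L(f,g)=\{(x,y)\in\mathbb{R}^2 : a\le x\le b,\ f(x)\le y\le g(x)\}$ is then called a lune with domain $[a,b]$, and $S_L=\{x\in[a,b] : f(x)<g(x)\}$ its support. Assume that $L$ is simple, i.e. that $S_L$ is a nonempty interval; then $S_L=(c,d)$ for some $a\le c<d\le b$. Equip $C^\infty([a,b])$ with the topology generated by the sets $\{G : \|G-F\|_k<\varepsilon\}$ ($F\in C^\infty([a,b])$, $k\ge 0$, $\varepsilon>0$), where $\|F\|_k=\max_{0\le i\le k}\sup_{[a,b]}|F^{(i)}|$. Then there exist a Peano curve $\gamma:[0,1]\to L$ (a continuous curve whose image has nonempty interior in $\mathbb{R}^2$), a continuous map $t\in[0,1]\mapsto F_t\in C^\infty([a,b])$, and a continuous function $\psi:L\to\mathbb{R}$ such that: (i) $F_0=f$ and $F_1=g$; (ii) if $t\le s$ then $F_t(x)\le F_s(x)$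 for all $x\in[a,b]$; (iii) writing $\gamma(t)=(x(t),y(t))$, we have $y(t)=F_t(x(t))$ for all $t\in[0,1]$; (iv) $F_t'(x)=\psi(x,F_t(x))$ for all $t\in[0,1]$ and $x\in[a,b]$; (v) for each $t\in(0,1]$, $L(f,F_t)$ is a lune (that is, $f\le F_t$ and all derivatives of $f$ and $F_t$ agree at $a$ and at $b$) and $\gamma([0,t])=\overline{\operatorname{int}L(f,F_t)}$; (vi) $\gamma(0)=(c,f(c))$ and $\gamma(1)=(d,f(d))$; in particular $\gamma(0)=(a,f(a))$ and $\gamma(1)=(b,f(b))$ when $S_L=(a,b)$. -/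

import Mathlib

open Set
open scoped ContDiff

noncomputable section

/-- The set `C^∞([a,b])` of smooth functions on the closed interval `[a,b]`
(one-sided derivatives at the endpoints). -/
structure SmoothFun (a b : ℝ) where
  /-- The underlying function on `[a,b]`. -/
  toFun : Icc a b → ℝ
  contDiffOn' : ContDiffOn ℝ ∞ (Function.extend Subtype.val toFun 0) (Icc a b)

namespace SmoothFun

variable {a b : ℝ}

/-- The value of `F` at a real number `x` if `x ∈ [a,b]`, and `0` otherwise. -/
def eval (F : SmoothFun a b) : ℝ → ℝ := Function.extend Subtype.val F.toFun 0

instance : CoeFun (SmoothFun a b) (fun _ => ℝ → ℝ) := ⟨eval⟩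

theorem coe_apply (F : SmoothFun a b) (x : Icc a b) : F (x : ℝ) = F.toFun x :=
  Subtype.val_injective.extend_apply F.toFun 0 x

theorem coe_of_notMem (F : SmoothFun a b) {x : ℝ} (hx : x ∉ Icc a b) : F x = (0 : ℝ) := by
  refine Function.extend_apply' F.toFun (0 : ℝ → ℝ) x ?_
  rintro ⟨y, rfl⟩
  exact hx y.2

theorem contDiffOn (F : SmoothFun a b) : ContDiffOn ℝ ∞ F (Icc a b) := F.contDiffOn'

/-- The pointwise difference of two smooth functions. -/
instance : Sub (SmoothFun a b) where
  sub F G :=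
    { toFun := fun x => F.toFun x - G.toFun x
      contDiffOn' := by
        refine (F.contDiffOn.sub G.contDiffOn).congr ?_
        intro x hx
        have h := Subtype.val_injective.extend_apply
          (fun y : Icc a b => F.toFun y - G.toFun y) 0 ⟨x, hx⟩
        have hF := F.coe_apply ⟨x, hx⟩
        have hG := G.coe_apply ⟨x, hx⟩
        simp only at h hF hG
        rw [h, ← hF, ← hG] }

/-- The `i`-th derivative `F^{(i)}` on `[a,b]`. -/
def iterDeriv (i : ℕ) (F : SmoothFun a b) : ℝ → ℝ :=
  iteratedDerivWithin i F (Icc a b)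

/-- The `C^k` norm `max (‖F‖₀, ‖F'‖₀, …, ‖F^{(k)}‖₀)`, with `‖·‖₀` the supremum over `[a,b]`. -/
def ckNorm (k : ℕ) (F : SmoothFun a b) : ℝ :=
  (Finset.range (k + 1)).sup' Finset.nonempty_range_add_one
    (fun i => ⨆ x : Icc a b, |iterDeriv i F x|)

/-- The basic neighborhood `N(F, k, ε)`. -/
def basicNhd (F : SmoothFun a b) (k : ℕ) (ε : ℝ) : Set (SmoothFun a b) :=
  {G | ckNorm k (G - F) < ε}

/-- The `C^∞` topology: the topology generated by the basic neighborhoods. -/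
instance : TopologicalSpace (SmoothFun a b) :=
  TopologicalSpace.generateFrom
    {U | ∃ (F : SmoothFun a b) (k : ℕ) (ε : ℝ), 0 < ε ∧ U = basicNhd F k ε}

end SmoothFun

/-- The region `{(x,y) | a ≤ x ≤ b, f x ≤ y ≤ g x}`. -/
def lune {a b : ℝ} (f g : SmoothFun a b) : Set (ℝ × ℝ) :=
  {p | p.1 ∈ Icc a b ∧ f p.1 ≤ p.2 ∧ p.2 ≤ g p.1}

/-- The conditions on `f`, `g` under which the region `lune f g` is called a lune. -/
structure IsLune {a b : ℝ} (f g : SmoothFun a b) : Prop where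
  deriv_left : ∀ k : ℕ, f.iterDeriv k a = g.iterDeriv k a
  deriv_right : ∀ k : ℕ, f.iterDeriv k b = g.iterDeriv k b
  le : ∀ x ∈ Icc a b, f x ≤ g x

/-- The support of a lune. -/
def luneSupport {a b : ℝ} (f g : SmoothFun a b) : Set ℝ :=
  {x | x ∈ Icc a b ∧ f x < g x}

/-- A lune is simple if its support is a nonempty interval. -/
structure IsSimpleLune {a b : ℝ} (f g : SmoothFun a b) : Prop extends IsLune f g where
  support_nonempty : (luneSupport f g).Nonempty
  support_ordConnected : (luneSupport f g).OrdConnected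

/-- The essential part of a lune: the closure of its interior. -/
def essLune {a b : ℝ} (f g : SmoothFun a b) : Set (ℝ × ℝ) :=
  closure (interior (lune f g))

/-- A Peano curve: a continuous plane curve whose image has nonempty interior. -/
def IsPeanoCurve (γ : unitInterval → ℝ × ℝ) : Prop :=
  Continuous γ ∧ (interior (range γ)).Nonempty

end

/-!
Write `h = g - f`, which is positive exactly on the open interval `(c, d)`.  The fronts are sought
in the form `F t = f + h * Φ t`, where `Φ t` increases from `0` to a bump function `β` that is `1`
on `[a,b]`.  The flatness of `h` at `a` and `b` then makes each `L(f, F t)` a lune, whatever `Φ` is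
(`IsLune.interpolate`), so only `Φ` and the horizontal motion `X` of the curve have to be built;
the curve is `γ t = (X t, F t (X t))`.

`Φ` and `X` are limits of finite approximations, called stacks: `β` is cut into finitely many
smooth pieces `φ i ≥ 0` lying over intervals with end points `e i` and `e (i + 1)`, which are swept
out one after the other along the chain `c = e 0, …, e K = d`.  A stack is refined in two steps.
`Stack.layer` replaces each piece by an odd number `M` of copies of its `M`-th part, traversed back
and forth.  `Stack.zig` then cuts a piece leading from `u` to `v` into three pieces that are swept
out along the zigzag `0 → 2/3 → 1/3 → 1` of the way from `u` to `v`.  The zigzag makes the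
intervals shorter by the factor `2/3`, so the curve becomes continuous in the limit.  The cut-off
functions used for it have large derivatives, but these are chosen before `M`, and the layering
divides them by `M`; hence a large `M` makes the pieces as small as desired together with any number
of derivatives (`Stack.exists_refinement`).  Therefore the approximations converge, uniformly in
time, with all derivatives in `x` (`digitLim_equicontinuous`, `iteratedDeriv_digitLim`,
`exists_isSweep`), which gives continuity of `t ↦ F t` in the `C^∞` topology.

The image of `[0, t]` is the essential part of `L(f, F t)` (`IsLuneSweep.image_curve`): an interior
point lies at every scale in some piece, and this piece is swept out while the curve is close to the
point; conversely, the curve enters each piece at a boundary point of the open region that this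
piece sweeps out.
The slope function `ψ` needs no construction, since `(t, x) ↦ (x, F t x)` is a quotient map onto the
lune, and two fronts meeting at a point are ordered and hence tangent there
(`IsLuneSweep.exists_slope`).
-/

noncomputable section

/-! ### Limits along successive subdivisions of the unit interval -/

/-- The limit at time `t` of the values `A n ⌊K n * t⌋₊` read off at level `n` of a sequence of
subdivisions of the time axis, level `n` having mesh `1 / K n`; it is written as a telescoping
series so that it can be differentiated termwise in a parameter. -/
def digitLim (K : ℕ → ℕ) (A : ℕ → ℕ → ℝ) (t : ℝ) : ℝ :=
  A 0 ⌊K 0 * t⌋₊ + ∑' n, (A (n + 1) ⌊K (n + 1) * t⌋₊ - A n ⌊K n * t⌋₊)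

/-- `A` and the subdivisions `K` are compatible up to the errors `B`: each cell of level `n` is cut
into `m n` cells of level `n + 1`, and on these `A (n + 1)` differs from `A n` by at most `B n`. -/
structure IsDigitApprox (K m : ℕ → ℕ) (A : ℕ → ℕ → ℝ) (B : ℕ → ℝ) : Prop where
  pos : ∀ n, 0 < K n
  mul : ∀ n, K (n + 1) = m n * K n
  le : ∀ n q, |A (n + 1) q - A n (q / m n)| ≤ B n
  summable : Summable B

namespace IsDigitApprox

variable {K m : ℕ → ℕ} {A : ℕ → ℕ → ℝ} {B : ℕ → ℝ}

theorem factor_pos (h : IsDigitApprox K m A B) (n : ℕ) : 0 < m n := by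
  have := h.pos (n + 1)
  rw [h.mul] at this
  exact Nat.pos_of_mul_pos_right this

theorem floor_div (h : IsDigitApprox K m A B) (n : ℕ) (t : ℝ) :
    ⌊K (n + 1) * t⌋₊ / m n = ⌊K n * t⌋₊ := by
  rw [← Nat.floor_div_natCast, h.mul]
  have : (m n : ℝ) ≠ 0 := by exact_mod_cast (h.factor_pos n).ne'
  congr 1
  push_cast
  field_simp

theorem step_le (h : IsDigitApprox K m A B) (n : ℕ) (t : ℝ) :
    |A (n + 1) ⌊K (n + 1) * t⌋₊ - A n ⌊K n * t⌋₊| ≤ B n := by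
  have := h.le n ⌊K (n + 1) * t⌋₊
  rwa [h.floor_div] at this

theorem summable_step (h : IsDigitApprox K m A B) (t : ℝ) :
    Summable fun n => A (n + 1) ⌊K (n + 1) * t⌋₊ - A n ⌊K n * t⌋₊ :=
  Summable.of_norm_bounded h.summable fun n => h.step_le n t

theorem abs_sub_le (h : IsDigitApprox K m A B) (n : ℕ) (t : ℝ) :
    |digitLim K A t - A n ⌊K n * t⌋₊| ≤ ∑' i, B (i + n) := by
  have hs := h.summable_step t
  have h1 := hs.sum_add_tsum_nat_add n
  rw [Finset.sum_range_sub (fun n => A n ⌊K n * t⌋₊)] at h1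
  have h2 : digitLim K A t - A n ⌊K n * t⌋₊ =
      ∑' i, (A (i + n + 1) ⌊K (i + n + 1) * t⌋₊ - A (i + n) ⌊K (i + n) * t⌋₊) := by
    unfold digitLim
    linarith
  rw [h2, ← Real.norm_eq_abs]
  refine tsum_of_norm_bounded (g := fun i => B (i + n))
    ((summable_nat_add_iff n).2 h.summable).hasSum fun i => ?_
  exact h.step_le (i + n) t

theorem tendsto (h : IsDigitApprox K m A B) (t : ℝ) :
    Filter.Tendsto (fun n => A n ⌊K n * t⌋₊) Filter.atTop (nhds (digitLim K A t)) := by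
  rw [tendsto_iff_dist_tendsto_zero]
  refine squeeze_zero (fun _ => dist_nonneg) (fun n => ?_) (tendsto_sum_nat_add B)
  rw [dist_comm]
  exact h.abs_sub_le n t

theorem mono (h : IsDigitApprox K m A B) (hA : ∀ n, Monotone (A n)) :
    Monotone (digitLim K A) := fun t s hts =>
  le_of_tendsto_of_tendsto' (h.tendsto t) (h.tendsto s) fun n =>
    hA n (Nat.floor_mono (by gcongr))

theorem eq_at_node (h : IsDigitApprox K m A B) (hA : ∀ n i, A (n + 1) (m n * i) = A n i)
    (n i : ℕ) : digitLim K A (i / K n) = A n i := by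
  have key : ∀ p, ∃ N : ℕ, (K (p + n) : ℝ) * (i / K n) = N ∧ A (p + n) N = A n i := by
    intro p
    induction p with
    | zero =>
      have : (K n : ℝ) ≠ 0 := by exact_mod_cast (h.pos n).ne'
      exact ⟨i, by rw [zero_add]; field_simp, by rw [zero_add]⟩
    | succ p ih =>
      obtain ⟨N, h1, h2⟩ := ih
      refine ⟨m (p + n) * N, ?_, ?_⟩
      · rw [show p + 1 + n = p + n + 1 by ring, h.mul]
        push_cast
        rw [mul_assoc, h1]
      · rw [show p + 1 + n = p + n + 1 by ring, hA, h2]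
  refine tendsto_nhds_unique ((Filter.tendsto_add_atTop_iff_nat n).2 (h.tendsto _)) ?_
  refine tendsto_const_nhds.congr fun p => ?_
  obtain ⟨N, h1, h2⟩ := key p
  rw [h1, Nat.floor_natCast, h2]

theorem zero (h : IsDigitApprox K m A B) (hA : ∀ n i, A (n + 1) (m n * i) = A n i) :
    digitLim K A 0 = A 0 0 := by
  simpa using h.eq_at_node hA 0 0

theorem one (h : IsDigitApprox K m A B) (hA : ∀ n i, A (n + 1) (m n * i) = A n i) :
    digitLim K A 1 = A 0 (K 0) := by
  have := h.eq_at_node hA 0 (K 0)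
  rwa [div_self (by exact_mod_cast (h.pos 0).ne')] at this

end IsDigitApprox

/-- If the increments of `A n` tend to zero, the limit depends on time uniformly continuously, and
this uniformly in a parameter as soon as the estimates are uniform. -/
theorem digitLim_equicontinuous {X : Type*} {K m : ℕ → ℕ} {A : X → ℕ → ℕ → ℝ} {B D : ℕ → ℝ}
    (h : ∀ x, IsDigitApprox K m (A x) B) (hD : ∀ x n i, |A x n (i + 1) - A x n i| ≤ D n)
    (hD0 : Filter.Tendsto D Filter.atTop (nhds 0)) {ε : ℝ} (hε : 0 < ε) :
    ∃ δ > 0, ∀ t s : ℝ, 0 ≤ t → 0 ≤ s → |t - s| < δ →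
      ∀ x, |digitLim K (A x) t - digitLim K (A x) s| < ε := by
  obtain ⟨n, hn1, hn2⟩ := (((tendsto_sum_nat_add B).eventually (gt_mem_nhds (show 0 < ε / 3 by
    linarith))).and (hD0.eventually (gt_mem_nhds (show 0 < ε / 3 by linarith)))).exists
  have key : ∀ t s : ℝ, 0 ≤ t → 0 ≤ s → s ≤ t → |t - s| < 1 / (K n + 1) →
      ∀ x, |digitLim K (A x) t - digitLim K (A x) s| < ε := by
    intro t s ht hs hst hd x
    have hK : (0 : ℝ) ≤ K n := Nat.cast_nonneg _
    have hmid : |A x n ⌊K n * t⌋₊ - A x n ⌊K n * s⌋₊| < ε / 3 := by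
      have h1 : ⌊K n * s⌋₊ ≤ ⌊K n * t⌋₊ := Nat.floor_mono (by gcongr)
      have h2 : ⌊K n * t⌋₊ ≤ ⌊K n * s⌋₊ + 1 := by
        rw [← Nat.floor_add_one (by positivity)]
        refine Nat.floor_mono ?_
        rw [abs_of_nonneg (by linarith), lt_div_iff₀ (by linarith)] at hd
        nlinarith
      rcases (by omega : ⌊K n * t⌋₊ = ⌊K n * s⌋₊ ∨ ⌊K n * t⌋₊ = ⌊K n * s⌋₊ + 1) with h3 | h3
      · rw [h3, sub_self, abs_zero]; linarith
      · rw [h3]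
        exact (hD x n _).trans_lt hn2
    have e1 := (h x).abs_sub_le n t
    have e2 := (h x).abs_sub_le n s
    rw [abs_le] at e1 e2
    rw [abs_lt] at hmid ⊢
    constructor <;> linarith
  refine ⟨1 / (K n + 1), by positivity, fun t s ht hs hd x => ?_⟩
  rcases le_total s t with hst | hst
  · exact key t s ht hs hst hd x
  · rw [abs_sub_comm]
    exact key s t hs ht hst (by rwa [abs_sub_comm]) x

/-- Termwise differentiation of `digitLim` in a parameter. -/
theorem iteratedDeriv_digitLim {K m : ℕ → ℕ} {S : ℕ → ℕ → ℝ → ℝ} {B : ℕ → ℕ → ℝ}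
    (hS : ∀ n i, ContDiff ℝ ∞ (S n i))
    (h : ∀ k x, IsDigitApprox K m (fun n i => iteratedDeriv k (S n i) x) (B k)) (t : ℝ) :
    ContDiff ℝ ∞ (fun x => digitLim K (fun n i => S n i x) t) ∧
    ∀ k x, iteratedDeriv k (fun x => digitLim K (fun n i => S n i x) t) x =
      digitLim K (fun n i => iteratedDeriv k (S n i) x) t := by
  set f : ℕ → ℝ → ℝ := fun n x => S (n + 1) ⌊K (n + 1) * t⌋₊ x - S n ⌊K n * t⌋₊ x with hf
  have hfc : ∀ n, ContDiff ℝ ∞ (f n) := fun n => (hS _ _).sub (hS _ _)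
  have hfk : ∀ k n x, iteratedDeriv k (f n) x =
      iteratedDeriv k (S (n + 1) ⌊K (n + 1) * t⌋₊) x - iteratedDeriv k (S n ⌊K n * t⌋₊) x := by
    intro k n x
    exact iteratedDeriv_fun_sub ((hS _ _).of_le (mod_cast le_top)).contDiffAt
      ((hS _ _).of_le (mod_cast le_top)).contDiffAt
  have hb : ∀ (k n : ℕ) (x : ℝ), ((k : ℕ∞) ≤ (⊤ : ℕ∞)) → ‖iteratedFDeriv ℝ k (f n) x‖ ≤ B k n := by
    intro k n x _
    rw [norm_iteratedFDeriv_eq_norm_iteratedDeriv, hfk]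
    exact (h k x).step_le n t
  have hsum : ∀ k : ℕ, ((k : ℕ∞) ≤ (⊤ : ℕ∞)) → Summable (B k) := fun k _ => (h k 0).summable
  have hc : ContDiff ℝ ∞ (fun x => ∑' n, f n x) :=
    contDiff_tsum (N := ⊤) hfc hsum hb
  refine ⟨(hS _ _).add hc, fun k x => ?_⟩
  have h1 : iteratedDeriv k (fun x => ∑' n, f n x) x = ∑' n, iteratedDeriv k (f n) x := by
    simp only [iteratedDeriv_eq_iteratedFDeriv]
    have h2 := iteratedFDeriv_tsum_apply (N := ⊤) hfc hsum hb (k := k) le_top x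
    rw [h2, ← ContinuousMultilinearMap.tsum_eval]
    refine Summable.of_norm_bounded (hsum k le_top) fun n => hb k n x le_top
  have h3 := iteratedDeriv_fun_add (n := k) (x := x)
    ((hS 0 ⌊K 0 * t⌋₊).of_le (mod_cast le_top)).contDiffAt
    (hc.of_le (mod_cast le_top)).contDiffAt
  unfold digitLim
  rw [← h1.trans (tsum_congr fun n => hfk k n x), ← h3]

/-! ### Gluing over subdivided cells -/

/-- The sequence that on the `i`-th block of `m` consecutive indices runs through
`a i 0, …, a i (m - 1)`. -/
def glue {α : Type*} (m : ℕ) (a : ℕ → ℕ → α) (q : ℕ) : α := a (q / m) (q % m)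

theorem glue_mul {α : Type*} {m : ℕ} (hm : 0 < m) (a : ℕ → ℕ → α) (i : ℕ) :
    glue m a (m * i) = a i 0 := by
  simp [glue, hm]

theorem glue_succ {α : Type*} {m : ℕ} (hm : 0 < m) {a : ℕ → ℕ → α}
    (ha : ∀ i, a i m = a (i + 1) 0) (q : ℕ) :
    glue m a (q + 1) = a (q / m) (q % m + 1) := by
  have h := Nat.mod_lt q hm
  have h0 := Nat.div_add_mod q m
  unfold glue
  rcases Nat.lt_or_ge (q % m + 1) m with h1 | h1
  · have e : q + 1 = (q % m + 1) + m * (q / m) := by omega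
    rw [e, Nat.add_mul_div_left _ _ hm, Nat.add_mul_mod_self_left, Nat.div_eq_of_lt h1,
      Nat.mod_eq_of_lt h1, zero_add]
  · have e1 : q % m + 1 = m := by omega
    have e : q + 1 = m * (q / m + 1) := by rw [mul_add]; omega
    rw [e1, ha, e, Nat.mul_div_cancel_left _ hm, Nat.mul_mod_right]

/-! ### The zigzag partition of unity -/

/-- A smooth step that is `1` on the first third of the way from `u` to `v` and `0` on the last. -/
def stepFun (u v x : ℝ) : ℝ := Real.smoothTransition (2 - 3 * ((x - u) * (v - u)⁻¹))

/-- The partial sums `0, θ², 1 - (1 - θ)², 1` of the partition of unity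
`θ² + 2 θ (1 - θ) + (1 - θ)² = 1` built from `θ = stepFun u v`; its members live on the first two
thirds, the middle third, and the last two thirds of the way from `u` to `v`. -/
def zigSum (u v : ℝ) : ℕ → ℝ → ℝ
  | 0, _ => 0
  | 1, x => stepFun u v x ^ 2
  | 2, x => 1 - (1 - stepFun u v x) ^ 2
  | _ + 3, _ => 1

/-- The corner points, at `0, 2/3, 1/3, 1`, of the zigzag from `u` to `v`. -/
def zigPoint (u v : ℝ) : ℕ → ℝ
  | 0 => u
  | 1 => u + 2 / 3 * (v - u)
  | 2 => u + 1 / 3 * (v - u)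
  | _ + 3 => v

theorem contDiff_stepFun (u v : ℝ) : ContDiff ℝ ∞ (stepFun u v) := by
  unfold stepFun
  exact Real.smoothTransition.contDiff.comp (by fun_prop)

theorem contDiff_zigSum (u v : ℝ) : ∀ r, ContDiff ℝ ∞ (zigSum u v r)
  | 0 => contDiff_const
  | 1 => (contDiff_stepFun u v).pow 2
  | 2 => contDiff_const.sub ((contDiff_const.sub (contDiff_stepFun u v)).pow 2)
  | _ + 3 => contDiff_const

theorem stepFun_nonneg (u v x : ℝ) : 0 ≤ stepFun u v x := Real.smoothTransition.nonneg _

theorem stepFun_le_one (u v x : ℝ) : stepFun u v x ≤ 1 := Real.smoothTransition.le_one _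

theorem zigSum_mono (u v x : ℝ) : ∀ r, zigSum u v r x ≤ zigSum u v (r + 1) x
  | 0 => by simp only [zigSum]; positivity
  | 1 => by
    simp only [zigSum]
    nlinarith [stepFun_nonneg u v x, stepFun_le_one u v x]
  | 2 => by
    simp only [zigSum]
    nlinarith [sq_nonneg (1 - stepFun u v x)]
  | _ + 3 => le_refl (1 : ℝ)

/-- For `x` strictly between `u` and `v`, the `r`-th member of the partition is positive exactly
when `x` is strictly between the `r`-th and the `r + 1`-st corner of the zigzag. -/
theorem zigSum_lt_iff {u v x : ℝ} (h : (x - u) * (x - v) < 0) {r : ℕ} (hr : r < 3) :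
    zigSum u v r x < zigSum u v (r + 1) x ↔
      (x - zigPoint u v r) * (x - zigPoint u v (r + 1)) < 0 := by
  have hne : v - u ≠ 0 := by
    intro h0
    rw [show v = u by linarith] at h
    nlinarith [mul_self_nonneg (x - u)]
  obtain ⟨s, rfl⟩ : ∃ s, x = u + s * (v - u) := ⟨(x - u) / (v - u), by field_simp; ring⟩
  have hpos : 0 < (v - u) ^ 2 := by positivity
  have hcell : ∀ α β : ℝ, (u + s * (v - u) - (u + α * (v - u))) *
      (u + s * (v - u) - (u + β * (v - u))) < 0 ↔ (s - α) * (s - β) < 0 := by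
    intro α β
    rw [show (u + s * (v - u) - (u + α * (v - u))) * (u + s * (v - u) - (u + β * (v - u))) =
      (v - u) ^ 2 * ((s - α) * (s - β)) by ring]
    simp [mul_neg_iff, hpos, hpos.not_gt]
  have hs : 0 < s ∧ s < 1 := by
    have := (hcell 0 1).1 (by ring_nf at h ⊢; exact h)
    constructor <;> nlinarith
  have harg : stepFun u v (u + s * (v - u)) = Real.smoothTransition (2 - 3 * s) := by
    unfold stepFun
    congr 3
    field_simp
    ring
  have hn := Real.smoothTransition.nonneg (2 - 3 * s)
  have hl := Real.smoothTransition.le_one (2 - 3 * s)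
  have hzero : 0 < Real.smoothTransition (2 - 3 * s) ↔ s < 2 / 3 := by
    rw [lt_iff_le_and_ne, ne_comm, Ne, Real.smoothTransition.zero_iff_nonpos]
    constructor
    · rintro ⟨-, h⟩; linarith
    · intro h; exact ⟨hn, by linarith⟩
  have hone : Real.smoothTransition (2 - 3 * s) < 1 ↔ 1 / 3 < s := by
    rw [lt_iff_le_and_ne, Ne, Real.smoothTransition.eq_one_iff_one_le]
    constructor
    · rintro ⟨-, h⟩; linarith
    · intro h; exact ⟨hl, by linarith⟩
  set θ := Real.smoothTransition (2 - 3 * s)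
  have e0 := hcell 0 (2 / 3)
  have e1 := hcell (2 / 3) (1 / 3)
  have e2 := hcell (1 / 3) 1
  rw [zero_mul, add_zero] at e0
  rw [one_mul, add_sub_cancel] at e2
  interval_cases r
  · simp only [zigSum, zigPoint, harg]
    rw [e0]
    constructor
    · intro h0
      have := hzero.1 (lt_of_le_of_ne hn (by rintro h1; rw [← h1] at h0; simp at h0))
      nlinarith
    · intro h0
      have := hzero.2 (by nlinarith)
      positivity
  · simp only [zigSum, zigPoint, harg]
    rw [e1]
    constructor
    · intro h0
      have h0' : 0 < θ * (1 - θ) := by nlinarith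
      have h1 := hzero.1 (by nlinarith)
      have h2 := hone.1 (by nlinarith)
      nlinarith
    · intro h0
      have h1 := hzero.2 (by nlinarith)
      have h2 := hone.2 (by nlinarith)
      nlinarith [mul_pos h1 (sub_pos.2 h2)]
  · simp only [zigSum, zigPoint, harg]
    rw [e2]
    constructor
    · intro h0
      have h0' : 0 < (1 - θ) ^ 2 := by linarith
      have h2 := hone.1 (lt_of_le_of_ne hl (by intro h1; rw [h1] at h0'; simp at h0'))
      nlinarith
    · intro h0
      have h2 := hone.2 (by nlinarith)
      nlinarith [mul_pos (sub_pos.2 h2) (sub_pos.2 h2)]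

theorem zigPoint_self (u : ℝ) : ∀ r, zigPoint u u r = u
  | 0 | 1 | 2 | _ + 3 => by simp [zigPoint]

theorem zigPoint_ne_succ {u v : ℝ} (h : u ≠ v) {r : ℕ} (hr : r < 3) :
    zigPoint u v r ≠ zigPoint u v (r + 1) := by
  intro he
  apply h
  interval_cases r <;> simp only [zigPoint] at he <;> linarith

theorem zigPoint_mem {c d u v : ℝ} (hu : u ∈ Icc c d) (hv : v ∈ Icc c d) :
    ∀ r, zigPoint u v r ∈ Icc c d
  | 0 => hu
  | 1 => by simp only [zigPoint, mem_Icc] at *; constructor <;> linarith [hu.1, hu.2, hv.1, hv.2]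
  | 2 => by simp only [zigPoint, mem_Icc] at *; constructor <;> linarith [hu.1, hu.2, hv.1, hv.2]
  | _ + 3 => hv

theorem abs_zigPoint_succ_sub_le (u v : ℝ) {r : ℕ} (hr : r < 3) :
    |zigPoint u v (r + 1) - zigPoint u v r| ≤ 2 / 3 * |v - u| := by
  have h2 : |(2 : ℝ) / 3 * (v - u)| = 2 / 3 * |v - u| := by rw [abs_mul]; norm_num
  interval_cases r
  · rw [← h2]; apply le_of_eq; simp only [zigPoint]; congr 1; ring
  · simp only [zigPoint]
    rw [show u + 1 / 3 * (v - u) - (u + 2 / 3 * (v - u)) = - (1 / 3 * (v - u)) by ring, abs_neg,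
      abs_mul]
    gcongr
    norm_num
  · rw [← h2]; apply le_of_eq; simp only [zigPoint]; congr 1; ring

theorem abs_zigPoint_sub_le (u v : ℝ) : ∀ r, |zigPoint u v r - u| ≤ |v - u|
  | 0 => by simp [zigPoint]
  | 1 => by
    simp only [zigPoint, add_sub_cancel_left, abs_mul]
    rw [abs_of_pos (by norm_num : (0 : ℝ) < 2 / 3)]
    linarith [abs_nonneg (v - u)]
  | 2 => by
    simp only [zigPoint, add_sub_cancel_left, abs_mul]
    rw [abs_of_pos (by norm_num : (0 : ℝ) < 1 / 3)]
    linarith [abs_nonneg (v - u)]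
  | _ + 3 => le_refl _

/-! ### Stacks of thin pieces -/

/-- The bump `β` cut into `K` pieces stacked on top of each other: the `i`-th piece is
`S (i + 1) - S i`, and over `(c, d)` it is positive exactly between `e i` and `e (i + 1)`, so that
the pieces can be traversed one after the other along the chain `c = e 0, …, e K = d`.  Both
sequences are continued by constants beyond `K`. -/
structure Stack (c d : ℝ) (β : ℝ → ℝ) where
  /-- The number of pieces. -/
  K : ℕ
  /-- The points where one piece is left and the next one entered. -/
  e : ℕ → ℝ
  /-- The partial sums of the pieces. -/
  S : ℕ → ℝ → ℝ
  K_pos : 0 < K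
  e_zero : e 0 = c
  e_of_le : ∀ i, K ≤ i → e i = d
  e_mem : ∀ i, e i ∈ Icc c d
  e_ne : ∀ i, i < K → e i ≠ e (i + 1)
  S_zero : S 0 = fun _ => 0
  S_of_le : ∀ i, K ≤ i → S i = β
  contDiff : ∀ i, ContDiff ℝ ∞ (S i)
  compact : ∀ i, HasCompactSupport (S i)
  mono : ∀ i x, S i x ≤ S (i + 1) x
  lt_iff : ∀ i, ∀ x ∈ Ioo c d, S i x < S (i + 1) x ↔ (x - e i) * (x - e (i + 1)) < 0

namespace Stack

variable {c d : ℝ} {β : ℝ → ℝ}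

/-- The `i`-th piece of a stack. -/
def piece (L : Stack c d β) (i : ℕ) (x : ℝ) : ℝ := L.S (i + 1) x - L.S i x

theorem piece_nonneg (L : Stack c d β) (i : ℕ) (x : ℝ) : 0 ≤ L.piece i x :=
  sub_nonneg.2 (L.mono i x)

theorem piece_pos_iff (L : Stack c d β) (i : ℕ) {x : ℝ} (hx : x ∈ Ioo c d) :
    0 < L.piece i x ↔ (x - L.e i) * (x - L.e (i + 1)) < 0 :=
  sub_pos.trans (L.lt_iff i x hx)

theorem contDiff_piece (L : Stack c d β) (i : ℕ) : ContDiff ℝ ∞ (L.piece i) :=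
  (L.contDiff _).sub (L.contDiff _)

theorem compact_piece (L : Stack c d β) (i : ℕ) : HasCompactSupport (L.piece i) :=
  (L.compact _).sub (L.compact _)

theorem piece_of_le (L : Stack c d β) {i : ℕ} (hi : L.K ≤ i) : L.piece i = fun _ => 0 := by
  funext x
  simp [piece, L.S_of_le i hi, L.S_of_le (i + 1) (by omega)]

/-- The stack with the single piece `β`. -/
def single (hcd : c < d) (hβ : ContDiff ℝ ∞ β) (hβc : HasCompactSupport β) (h0 : ∀ x, 0 ≤ β x)
    (h1 : ∀ x ∈ Ioo c d, 0 < β x) : Stack c d β where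
  K := 1
  e i := if i = 0 then c else d
  S i x := if i = 0 then 0 else β x
  K_pos := one_pos
  e_zero := rfl
  e_of_le i hi := by simp [show i ≠ 0 by omega]
  e_mem i := by split_ifs <;> simp [hcd.le]
  e_ne i hi := by simp [show i = 0 by omega, hcd.ne]
  S_zero := rfl
  S_of_le i hi := by simp [show i ≠ 0 by omega]
  contDiff i := by split_ifs; exacts [contDiff_const, hβ]
  compact i := by split_ifs; exacts [HasCompactSupport.zero, hβc]
  mono i x := by split_ifs <;> simp_all
  lt_iff i x hx := by
    rcases Nat.eq_zero_or_pos i with rfl | hi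
    · simp only [zero_add, one_ne_zero, if_true, if_false]
      exact iff_of_true (h1 x hx) (mul_neg_of_pos_of_neg (by linarith [hx.1]) (by linarith [hx.2]))
    · simp only [show i ≠ 0 by omega, show i + 1 ≠ 0 by omega, if_false, lt_irrefl, false_iff,
        not_lt]
      exact mul_self_nonneg _

/-- Each piece is replaced by `M` copies of its `M`-th part, traversed back and forth; `M` is odd,
so that the traversal ends where the original one did. -/
def layer (L : Stack c d β) (M : ℕ) (hM : Odd M) : Stack c d β where
  K := M * L.K
  e := glue M fun i j => if Even j then L.e i else L.e (i + 1)
  S := glue M fun i j x => L.S i x + j / M * L.piece i x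
  K_pos := Nat.mul_pos hM.pos L.K_pos
  e_zero := by simp [glue, L.e_zero]
  e_of_le q hq := by
    have : L.K ≤ q / M := (Nat.le_div_iff_mul_le hM.pos).2 (by linarith)
    simp [glue, L.e_of_le _ this, L.e_of_le _ (this.trans (Nat.le_succ _))]
  e_mem q := by simp only [glue]; split_ifs <;> exact L.e_mem _
  e_ne q hq := by
    have h := L.e_ne (q / M) (Nat.div_lt_of_lt_mul hq)
    rw [glue_succ hM.pos (by intro i; simp [hM])]
    unfold glue
    by_cases hj : Even (q % M)
    · simpa [hj, Nat.even_add_one] using h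
    · simpa [hj, Nat.even_add_one] using h.symm
  S_zero := by simp [glue, L.S_zero]
  S_of_le q hq := by
    have : L.K ≤ q / M := (Nat.le_div_iff_mul_le hM.pos).2 (by linarith)
    funext x
    simp [glue, L.S_of_le _ this, L.piece_of_le this]
  contDiff q := (L.contDiff _).add (contDiff_const.mul (L.contDiff_piece _))
  compact q := (L.compact _).add ((L.compact_piece _).mul_left (f := fun _ => _))
  mono q x := by
    have hM0 : (M : ℝ) ≠ 0 := by exact_mod_cast hM.pos.ne'
    rw [glue_succ hM.pos (by intro i; funext x; simp [piece, hM0])]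
    unfold glue
    have := L.piece_nonneg (q / M) x
    push_cast
    gcongr
    linarith
  lt_iff q x hx := by
    have hM0 : (0 : ℝ) < M := by exact_mod_cast hM.pos
    rw [glue_succ hM.pos (by intro i; funext x; simp [piece, hM0.ne']),
      glue_succ hM.pos (by intro i; simp [hM])]
    unfold glue
    have h1 := L.piece_pos_iff (q / M) hx
    have h2 : (x - L.e (q / M + 1)) * (x - L.e (q / M)) =
      (x - L.e (q / M)) * (x - L.e (q / M + 1)) := mul_comm _ _
    have h3 : L.S (q / M) x + ((q % M : ℕ) : ℝ) / M * L.piece (q / M) x <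
        L.S (q / M) x + ((q % M + 1 : ℕ) : ℝ) / M * L.piece (q / M) x ↔
          0 < L.piece (q / M) x := by
      rw [add_lt_add_iff_left]
      push_cast
      rw [add_div, add_mul, lt_add_iff_pos_right]
      exact mul_pos_iff_of_pos_left (by positivity)
    rw [h3, h1]
    by_cases hj : Even (q % M)
    · simp [hj, Nat.even_add_one]
    · simp [hj, Nat.even_add_one, h2]

/-- Each piece, leading from `u` to `v`, is cut into three by the zigzag partition of unity. -/
def zig (L : Stack c d β) : Stack c d β where
  K := 3 * L.K
  e := glue 3 fun i => zigPoint (L.e i) (L.e (i + 1))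
  S := glue 3 fun i r x => L.S i x + zigSum (L.e i) (L.e (i + 1)) r x * L.piece i x
  K_pos := Nat.mul_pos three_pos L.K_pos
  e_zero := by simp [glue, L.e_zero, zigPoint]
  e_of_le q hq := by
    have : L.K ≤ q / 3 := by omega
    simp [glue, L.e_of_le _ this, L.e_of_le _ (this.trans (Nat.le_succ _)), zigPoint_self]
  e_mem q := zigPoint_mem (L.e_mem _) (L.e_mem _) _
  e_ne q hq := by
    rw [glue_succ three_pos (by intro i; simp [zigPoint])]
    exact zigPoint_ne_succ (L.e_ne (q / 3) (by omega)) (Nat.mod_lt q three_pos)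
  S_zero := by simp [glue, L.S_zero, zigSum]
  S_of_le q hq := by
    have : L.K ≤ q / 3 := by omega
    funext x
    simp [glue, L.S_of_le _ this, L.piece_of_le this]
  contDiff q := (L.contDiff _).add ((contDiff_zigSum _ _ _).mul (L.contDiff_piece _))
  compact q := (L.compact _).add ((L.compact_piece _).mul_left)
  mono q x := by
    rw [glue_succ three_pos (by intro i; funext x; simp [piece, zigSum])]
    unfold glue
    have := L.piece_nonneg (q / 3) x
    have := zigSum_mono (L.e (q / 3)) (L.e (q / 3 + 1)) x (q % 3)
    exact add_le_add_right (mul_le_mul_of_nonneg_right this ‹_›) _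
  lt_iff q x hx := by
    rw [glue_succ three_pos (by intro i; funext x; simp [piece, zigSum]),
      glue_succ three_pos (by intro i; simp [zigPoint])]
    unfold glue
    have h3 : q % 3 < 3 := Nat.mod_lt _ three_pos
    rw [add_lt_add_iff_left]
    rcases (L.piece_nonneg (q / 3) x).eq_or_lt with h0 | h0
    · rw [← h0]
      simp only [mul_zero, lt_irrefl, false_iff, not_lt]
      have h1 : ¬ (x - L.e (q / 3)) * (x - L.e (q / 3 + 1)) < 0 := by
        rw [← L.piece_pos_iff _ hx, ← h0]; exact lt_irrefl _
      rw [not_lt] at h1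
      -- a point that is not between two points is not between two points of their segment
      have h2 : ∀ u v : ℝ, 0 ≤ (x - u) * (x - v) →
          0 ≤ (x - zigPoint u v (q % 3)) * (x - zigPoint u v (q % 3 + 1)) := by
        intro u v huv
        have hsq := sq_nonneg (v - u)
        rcases mul_nonneg_iff.1 huv with ⟨ha, hb⟩ | ⟨ha, hb⟩
        · have := fun r => (zigPoint_mem (c := min u v) (d := x) (u := u) (v := v)
            ⟨min_le_left _ _, by linarith⟩ ⟨min_le_right _ _, by linarith⟩ r).2
          exact mul_nonneg (sub_nonneg.2 (this _)) (sub_nonneg.2 (this _))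
        · have := fun r => (zigPoint_mem (c := x) (d := max u v) (u := u) (v := v)
            ⟨by linarith, le_max_left _ _⟩ ⟨by linarith, le_max_right _ _⟩ r).1
          exact mul_nonneg_of_nonpos_of_nonpos (sub_nonpos.2 (this _)) (sub_nonpos.2 (this _))
      exact h2 _ _ h1
    · rw [mul_lt_mul_iff_left₀ h0]
      exact zigSum_lt_iff ((L.piece_pos_iff _ hx).1 h0) h3

end Stack

/-! ### Refinement of stacks -/

theorem exists_bound_iteratedDeriv {φ : ℝ → ℝ} (h : ContDiff ℝ ∞ φ) (hc : HasCompactSupport φ)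
    (k : ℕ) : ∃ C, ∀ x, |iteratedDeriv k φ x| ≤ C := by
  obtain ⟨C, hC⟩ := (h.continuous_iteratedFDeriv (m := k)
    (mod_cast le_top)).bounded_above_of_compact_support (hc.iteratedFDeriv k)
  refine ⟨C, fun x => ?_⟩
  rw [← Real.norm_eq_abs, ← norm_iteratedFDeriv_eq_norm_iteratedDeriv]
  exact hC x

theorem exists_uniform_bound {ι : Type*} [Finite ι] {f : ι → ℝ → ℝ}
    (h : ∀ i, ∃ C, ∀ x, |f i x| ≤ C) : ∃ C, 0 ≤ C ∧ ∀ i x, |f i x| ≤ C := by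
  choose C hC using h
  obtain ⟨D, hD⟩ := (Set.finite_range C).bddAbove
  exact ⟨max D 0, le_max_right _ _, fun i x =>
    (hC i x).trans ((hD (mem_range_self i)).trans (le_max_left _ _))⟩

namespace Stack

variable {c d : ℝ} {β : ℝ → ℝ}

theorem iteratedDeriv_succ (L : Stack c d β) (k i : ℕ) (x : ℝ) :
    iteratedDeriv k (L.S (i + 1)) x =
      iteratedDeriv k (L.S i) x + iteratedDeriv k (L.piece i) x := by
  have : iteratedDeriv k (L.piece i) x =
      iteratedDeriv k (L.S (i + 1)) x - iteratedDeriv k (L.S i) x :=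
    iteratedDeriv_fun_sub ((L.contDiff _).of_le (mod_cast le_top)).contDiffAt
      ((L.contDiff _).of_le (mod_cast le_top)).contDiffAt
  linarith

theorem exists_bound_piece (L : Stack c d β) (k : ℕ) :
    ∃ C, ∀ i x, |iteratedDeriv k (L.piece i) x| ≤ C := by
  obtain ⟨C, hC0, hC⟩ := exists_uniform_bound (ι := Fin L.K)
    (f := fun i => iteratedDeriv k (L.piece i))
    fun i => exists_bound_iteratedDeriv (L.contDiff_piece i) (L.compact_piece i) k
  refine ⟨C, fun i x => ?_⟩
  rcases Nat.lt_or_ge i L.K with hi | hi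
  · exact hC ⟨i, hi⟩ x
  · rwa [L.piece_of_le hi, iteratedDeriv_fun_const_zero, abs_zero]

/-- `L'` arises from `L` by cutting each piece into `m`, keeping the chain of entry points and the
partial sums at the old indices; the chain gets finer by the factor `2/3`, and on a cell of `L` the
data of `L'` stay close to those of `L`. -/
structure Refines (L L' : Stack c d β) (m : ℕ) : Prop where
  K_eq : L'.K = m * L.K
  three_le : 3 ≤ m
  e_mul : ∀ i, L'.e (m * i) = L.e i
  S_mul : ∀ i, L'.S (m * i) = L.S i
  mesh : ∀ δ, (∀ i, |L.e (i + 1) - L.e i| ≤ δ) → ∀ q, |L'.e (q + 1) - L'.e q| ≤ 2 / 3 * δ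
  e_close : ∀ δ, (∀ i, |L.e (i + 1) - L.e i| ≤ δ) → ∀ q, |L'.e q - L.e (q / m)| ≤ 2 * δ
  S_close : ∀ (k : ℕ) (C C' : ℝ), (∀ i x, |iteratedDeriv k (L.piece i) x| ≤ C) →
    (∀ i x, |iteratedDeriv k (L'.piece i) x| ≤ C') →
    ∀ q x, |iteratedDeriv k (L'.S q) x - iteratedDeriv k (L.S (q / m)) x| ≤ C + 2 * C'

section layer

variable (L : Stack c d β) {M : ℕ} (hM : Odd M)

theorem layer_e_succ_sub (q : ℕ) : (L.layer M hM).e (q + 1) - (L.layer M hM).e q =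
    if Even (q % M) then L.e (q / M + 1) - L.e (q / M) else L.e (q / M) - L.e (q / M + 1) := by
  have h : (L.layer M hM).e = glue M fun i j => if Even j then L.e i else L.e (i + 1) := rfl
  rw [h, glue_succ hM.pos (by intro i; simp [hM])]
  unfold glue
  by_cases hj : Even (q % M) <;> simp [hj, Nat.even_add_one]

/-- A piece of the layered stack leads from one end of an old piece to the other. -/
theorem layer_ends (q : ℕ) : ∃ o : Bool,
    (L.layer M hM).e q = (if o then L.e (q / M) else L.e (q / M + 1)) ∧
    (L.layer M hM).e (q + 1) = (if o then L.e (q / M + 1) else L.e (q / M)) := by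
  have h : (L.layer M hM).e = glue M fun i j => if Even j then L.e i else L.e (i + 1) := rfl
  refine ⟨decide (Even (q % M)), ?_, ?_⟩
  · rw [h]; simp [glue]
  · rw [h, glue_succ hM.pos (by intro i; simp [hM])]
    by_cases hj : Even (q % M) <;> simp [hj, Nat.even_add_one]

theorem layer_piece (q : ℕ) (x : ℝ) :
    (L.layer M hM).piece q x = (M : ℝ)⁻¹ * L.piece (q / M) x := by
  have hM0 : (M : ℝ) ≠ 0 := by exact_mod_cast hM.pos.ne'
  have h : (L.layer M hM).S = glue M fun i j x => L.S i x + j / M * L.piece i x := rfl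
  rw [piece, h, glue_succ hM.pos (by intro i; funext x; simp [piece, hM0])]
  unfold glue
  push_cast
  ring

theorem layer_S_close {k : ℕ} {C : ℝ} (hC : ∀ i x, |iteratedDeriv k (L.piece i) x| ≤ C)
    (q : ℕ) (x : ℝ) :
    |iteratedDeriv k ((L.layer M hM).S q) x - iteratedDeriv k (L.S (q / M)) x| ≤ C := by
  have hM0 : (0 : ℝ) < M := by exact_mod_cast hM.pos
  have h : (L.layer M hM).S q =
      fun x => L.S (q / M) x + ((q % M : ℕ) : ℝ) / M * L.piece (q / M) x := rfl
  have hp : ContDiffAt ℝ k (L.piece (q / M)) x :=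
    ((L.contDiff_piece (q / M)).of_le (mod_cast le_top)).contDiffAt
  rw [h, iteratedDeriv_fun_add ((L.contDiff _).of_le (mod_cast le_top)).contDiffAt
    (contDiffAt_const.mul hp), iteratedDeriv_const_mul _ hp, add_sub_cancel_left, abs_mul]
  have h1 : |((q % M : ℕ) : ℝ) / M| ≤ 1 := by
    rw [abs_of_nonneg (by positivity), div_le_one hM0]
    exact_mod_cast (Nat.mod_lt q hM.pos).le
  exact (mul_le_of_le_one_left (abs_nonneg _) h1).trans (hC _ _)

end layer

section zig

variable (L : Stack c d β)

theorem zig_piece (q : ℕ) (x : ℝ) : L.zig.piece q x =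
    (zigSum (L.e (q / 3)) (L.e (q / 3 + 1)) (q % 3 + 1) x -
      zigSum (L.e (q / 3)) (L.e (q / 3 + 1)) (q % 3) x) * L.piece (q / 3) x := by
  have h : L.zig.S =
    glue 3 fun i r x => L.S i x + zigSum (L.e i) (L.e (i + 1)) r x * L.piece i x := rfl
  rw [piece, h, glue_succ three_pos (by intro i; funext x; simp [piece, zigSum])]
  unfold glue
  ring

theorem zig_S_mul (i : ℕ) : L.zig.S (3 * i) = L.S i := by
  have h : L.zig.S =
    glue 3 fun i r x => L.S i x + zigSum (L.e i) (L.e (i + 1)) r x * L.piece i x := rfl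
  rw [h, glue_mul three_pos]
  simp [zigSum]

theorem zig_S_close {k : ℕ} {C : ℝ} (hC : ∀ i x, |iteratedDeriv k (L.zig.piece i) x| ≤ C)
    (q : ℕ) (x : ℝ) :
    |iteratedDeriv k (L.zig.S q) x - iteratedDeriv k (L.S (q / 3)) x| ≤ 2 * C := by
  rw [← L.zig_S_mul (q / 3)]
  have h0 := L.zig.iteratedDeriv_succ k (3 * (q / 3)) x
  have h1 := L.zig.iteratedDeriv_succ k (3 * (q / 3) + 1) x
  have b0 := hC (3 * (q / 3)) x
  have b1 := hC (3 * (q / 3) + 1) x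
  have hC0 := (abs_nonneg _).trans b0
  rw [abs_le] at b0 b1
  rcases (by omega : q = 3 * (q / 3) ∨ q = 3 * (q / 3) + 1 ∨ q = 3 * (q / 3) + 1 + 1) with
    h | h | h
  · rw [← h, sub_self, abs_zero]; linarith
  · rw [congrArg L.zig.S h, h0, abs_le]; constructor <;> linarith
  · rw [congrArg L.zig.S h, h1, h0, abs_le]; constructor <;> linarith

end zig

/-- Layering before cutting multiplies the pieces by `M⁻¹`, so that any number of derivatives of the
refined pieces can be made small although the zigzag cuts have steep slopes. -/
theorem exists_bound_zig_layer (L : Stack c d β) (N : ℕ) : ∃ C, ∀ (M : ℕ) (hM : Odd M), ∀ k ≤ N,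
    ∀ q x, |iteratedDeriv k ((L.layer M hM).zig.piece q) x| ≤ (M : ℝ)⁻¹ * C := by
  -- the cut pieces, in both orientations, before scaling
  let G : ℕ → ℕ → Bool → ℝ → ℝ := fun i r o x =>
    (zigSum (if o then L.e i else L.e (i + 1)) (if o then L.e (i + 1) else L.e i) (r + 1) x -
      zigSum (if o then L.e i else L.e (i + 1)) (if o then L.e (i + 1) else L.e i) r x) *
      L.piece i x
  have hG : ∀ i r o, ContDiff ℝ ∞ (G i r o) := fun i r o =>
    ((contDiff_zigSum _ _ _).sub (contDiff_zigSum _ _ _)).mul (L.contDiff_piece i)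
  obtain ⟨C, hC0, hC⟩ := exists_uniform_bound (ι := Fin L.K × Fin 3 × Bool × Fin (N + 1))
    (f := fun z => iteratedDeriv z.2.2.2 (G z.1 z.2.1 z.2.2.1))
    fun z => exists_bound_iteratedDeriv (hG _ _ _) (L.compact_piece _).mul_left _
  refine ⟨C, fun M hM k hk q x => ?_⟩
  have hM0 : (0 : ℝ) ≤ (M : ℝ)⁻¹ := by positivity
  obtain ⟨o, h1, h2⟩ := L.layer_ends hM (q / 3)
  have h3 : (L.layer M hM).zig.piece q = fun x => (M : ℝ)⁻¹ * G (q / 3 / M) (q % 3) o x := by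
    funext x
    rw [zig_piece, layer_piece, h1, h2]
    ring
  rw [h3, iteratedDeriv_const_mul _ ((hG _ _ _).of_le (mod_cast le_top)).contDiffAt, abs_mul,
    abs_of_nonneg hM0]
  gcongr
  rcases Nat.lt_or_ge (q / 3 / M) L.K with hi | hi
  · exact hC ⟨⟨_, hi⟩, ⟨q % 3, Nat.mod_lt _ three_pos⟩, o, ⟨k, by omega⟩⟩ x
  · have : G (q / 3 / M) (q % 3) o = fun _ => 0 := by
      funext x
      simp [G, L.piece_of_le hi]
    rwa [this, iteratedDeriv_fun_const_zero, abs_zero]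

theorem refines_zig_layer (L : Stack c d β) {M : ℕ} (hM : Odd M) :
    Refines L (L.layer M hM).zig (3 * M) where
  K_eq := by simp [zig, layer, mul_assoc]
  three_le := by have := hM.pos; omega
  e_mul i := by
    rw [mul_assoc]
    refine (glue_mul three_pos (fun i => zigPoint ((L.layer M hM).e i) ((L.layer M hM).e (i + 1)))
      (M * i)).trans ?_
    refine (glue_mul hM.pos (fun i j => if Even j then L.e i else L.e (i + 1)) i).trans ?_
    simp
  S_mul i := by
    rw [mul_assoc, zig_S_mul]
    refine (glue_mul hM.pos (fun i j x => L.S i x + j / M * L.piece i x) i).trans ?_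
    simp
  mesh δ hδ q := by
    have h : (L.layer M hM).zig.e =
      glue 3 fun i => zigPoint ((L.layer M hM).e i) ((L.layer M hM).e (i + 1)) := rfl
    rw [h, glue_succ three_pos (by intro i; simp [zigPoint])]
    refine (abs_zigPoint_succ_sub_le _ _ (Nat.mod_lt q three_pos)).trans ?_
    gcongr
    rw [layer_e_succ_sub]
    split_ifs
    · exact hδ _
    · rw [abs_sub_comm]; exact hδ _
  e_close δ hδ q := by
    have h1 : |(L.layer M hM).zig.e q - (L.layer M hM).e (q / 3)| ≤ δ := by
      refine (abs_zigPoint_sub_le _ _ _).trans ?_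
      rw [layer_e_succ_sub]
      split_ifs
      · exact hδ _
      · rw [abs_sub_comm]; exact hδ _
    have h2 : |(L.layer M hM).e (q / 3) - L.e (q / (3 * M))| ≤ δ := by
      rw [← Nat.div_div_eq_div_mul]
      obtain ⟨o, h1, -⟩ := L.layer_ends hM (q / 3)
      rw [h1]
      split_ifs
      · rw [sub_self, abs_zero]; exact (abs_nonneg _).trans (hδ 0)
      · exact hδ _
    have := abs_sub_le ((L.layer M hM).zig.e q) ((L.layer M hM).e (q / 3)) (L.e (q / (3 * M)))
    linarith
  S_close k C C' hC hC' q x := by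
    have h1 := (L.layer M hM).zig_S_close hC' q x
    have h2 := L.layer_S_close hM hC (q / 3) x
    rw [Nat.div_div_eq_div_mul] at h2
    have := abs_sub_le (iteratedDeriv k ((L.layer M hM).zig.S q) x)
      (iteratedDeriv k ((L.layer M hM).S (q / 3)) x) (iteratedDeriv k (L.S (q / (3 * M))) x)
    linarith

theorem exists_refinement (L : Stack c d β) (N : ℕ) {ε : ℝ} (hε : 0 < ε) :
    ∃ (L' : Stack c d β) (m : ℕ), Refines L L' m ∧
      ∀ k ≤ N, ∀ i x, |iteratedDeriv k (L'.piece i) x| ≤ ε := by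
  obtain ⟨C, hC⟩ := L.exists_bound_zig_layer N
  -- an odd number of layers exceeding `C / ε`
  obtain ⟨p, hp⟩ := exists_nat_gt (C / ε)
  have hM : Odd (2 * p + 1) := ⟨p, rfl⟩
  refine ⟨_, _, L.refines_zig_layer hM, fun k hk i x => (hC _ hM k hk i x).trans ?_⟩
  have hpos : (0 : ℝ) < (2 * p + 1 : ℕ) := by positivity
  rw [inv_mul_le_iff₀ hpos]
  rw [div_lt_iff₀ hε] at hp
  push_cast
  nlinarith [mul_nonneg (Nat.cast_nonneg (α := ℝ) p) hε.le]

/-- A sequence of successive refinements whose pieces tend to zero with all derivatives. -/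
theorem exists_refining_sequence (L₀ : Stack c d β) :
    ∃ (L : ℕ → Stack c d β) (m : ℕ → ℕ), ∀ n, Refines (L n) (L (n + 1)) (m n) ∧
      ∀ k ≤ n, ∀ i x, |iteratedDeriv k ((L (n + 1)).piece i) x| ≤ (1 / 2) ^ n := by
  choose next m h1 h2 using fun (L : Stack c d β) (n : ℕ) =>
    L.exists_refinement n (ε := (1 / 2) ^ n) (by positivity)
  let L : ℕ → Stack c d β := fun n => Nat.rec L₀ (fun n L => next L n) n
  exact ⟨L, fun n => m (L n) n, fun n => ⟨h1 (L n) n, h2 (L n) n⟩⟩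

end Stack

/-! ### Sweeping out a bump function -/

/-- `Φ` grows smoothly from `0` to `β` while `X` travels from `c` to `d`; at arbitrarily fine
subdivisions of the time interval both are given by stacks of arbitrarily narrow pieces, so that
`Φ` grows only near the current position `X`. -/
structure IsSweep (c d : ℝ) (β : ℝ → ℝ) (Φ : unitInterval → ℝ → ℝ) (X : unitInterval → ℝ) :
    Prop where
  contDiff : ∀ t, ContDiff ℝ ∞ (Φ t)
  continuous_iteratedDeriv :
    ∀ k, Continuous fun p : unitInterval × ℝ => iteratedDeriv k (Φ p.1) p.2
  continuous_pos : Continuous X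
  mono : ∀ x, Monotone fun t => Φ t x
  zero : Φ 0 = fun _ => 0
  one : Φ 1 = β
  pos_zero : X 0 = c
  pos_one : X 1 = d
  mem : ∀ t, X t ∈ Icc c d
  exists_stack : ∀ ε > 0, ∃ L : Stack c d β, (L.K : ℝ)⁻¹ ≤ ε ∧
    (∀ i, |L.e (i + 1) - L.e i| ≤ ε) ∧
    ∀ (t : unitInterval) (i : ℕ), (t : ℝ) = i / L.K → Φ t = L.S i ∧ X t = L.e i

theorem continuous_uncurry_of_equicontinuous {G : unitInterval → ℝ → ℝ}
    (hc : ∀ t, Continuous (G t))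
    (h : ∀ ε > 0, ∃ δ > 0, ∀ t s : unitInterval, |(t : ℝ) - s| < δ → ∀ x, |G t x - G s x| < ε) :
    Continuous fun p : unitInterval × ℝ => G p.1 p.2 := by
  rw [continuous_iff_continuousAt]
  rintro ⟨s, y⟩
  rw [Metric.continuousAt_iff]
  intro ε hε
  obtain ⟨δ, hδ, h1⟩ := h (ε / 2) (by linarith)
  obtain ⟨δ', hδ', h2⟩ := Metric.continuousAt_iff.1 ((hc s).continuousAt (x := y)) (ε / 2)
    (by linarith)
  refine ⟨min δ δ', lt_min hδ hδ', ?_⟩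
  rintro ⟨t, x⟩ hd
  rw [Prod.dist_eq, max_lt_iff, lt_min_iff, lt_min_iff] at hd
  have e1 := h1 t s hd.1.1 x
  have e2 := h2 hd.2.2
  rw [← Real.dist_eq] at e1
  exact (dist_triangle _ (G s x) _).trans_lt (by linarith)

theorem summable_of_geometric_tail {b : ℕ → ℝ} {k : ℕ}
    (h : ∀ n, k ≤ n → b (n + 1) = (1 / 2) ^ n) : Summable b := by
  refine (summable_nat_add_iff (k + 1)).1 ?_
  refine ((summable_nat_add_iff k).2 (summable_geometric_two)).congr fun n => ?_
  rw [← add_assoc, h _ (Nat.le_add_left k n)]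

theorem exists_isSweep {c d : ℝ} {β : ℝ → ℝ} (L₀ : Stack c d β) :
    ∃ Φ X, IsSweep c d β Φ X := by
  obtain ⟨L, m, hL⟩ := Stack.exists_refining_sequence L₀
  have hR := fun n => (hL n).1
  -- bounds for all derivatives of the pieces, geometric from the `k`-th level on
  have hb : ∀ n k : ℕ, ∃ C, (∀ i x, |iteratedDeriv k ((L n).piece i) x| ≤ C) ∧
      ∀ p, k ≤ p → n = p + 1 → C = (1 / 2) ^ p := by
    intro n k
    by_cases h : ∃ p, k ≤ p ∧ n = p + 1
    · obtain ⟨p, hp, rfl⟩ := h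
      refine ⟨(1 / 2) ^ p, (hL p).2 k hp, fun p' _ h => ?_⟩
      rw [Nat.succ_injective h]
    · obtain ⟨C, hC⟩ := (L n).exists_bound_piece k
      exact ⟨C, hC, fun p h1 h2 => absurd ⟨p, h1, h2⟩ h⟩
  choose b hb1 hb2 using hb
  have hbs : ∀ k, Summable fun n => b n k := fun k =>
    summable_of_geometric_tail (k := k) fun n hn => hb2 _ _ n hn rfl
  have hmesh : ∀ n, ∀ i, |(L n).e (i + 1) - (L n).e i| ≤ (2 / 3) ^ n * (d - c) := by
    intro n
    induction n with
    | zero =>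
      intro i
      have h1 := (L 0).e_mem i
      have h2 := (L 0).e_mem (i + 1)
      rw [mem_Icc] at h1 h2
      rw [pow_zero, one_mul, abs_le]
      constructor <;> linarith
    | succ n ih =>
      intro i
      refine ((hR n).mesh _ ih i).trans (le_of_eq ?_)
      ring
  have hgeom : Summable fun n : ℕ => ((2 : ℝ) / 3) ^ n * (d - c) :=
    (summable_geometric_of_lt_one (by norm_num) (by norm_num)).mul_right _
  let K : ℕ → ℕ := fun n => (L n).K
  have happS : ∀ k x, IsDigitApprox K m (fun n i => iteratedDeriv k ((L n).S i) x)
      (fun n => b n k + 2 * b (n + 1) k) := fun k x =>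
    { pos := fun n => (L n).K_pos
      mul := fun n => (hR n).K_eq
      le := fun n q => (hR n).S_close k _ _ (hb1 n k) (hb1 (n + 1) k) q x
      summable := (hbs k).add (((summable_nat_add_iff 1).2 (hbs k)).mul_left 2) }
  have happE : IsDigitApprox K m (fun n i => (L n).e i) (fun n => 2 * ((2 / 3) ^ n * (d - c))) :=
    { pos := fun n => (L n).K_pos
      mul := fun n => (hR n).K_eq
      le := fun n q => (hR n).e_close _ (hmesh n) q
      summable := hgeom.mul_left 2 }
  have happS0 : ∀ x, IsDigitApprox K m (fun n i => (L n).S i x)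
      (fun n => b n 0 + 2 * b (n + 1) 0) := by
    intro x
    simpa only [iteratedDeriv_zero] using happS 0 x
  have hnodeS : ∀ x n i, (L (n + 1)).S (m n * i) x = (L n).S i x := fun x n i => by
    rw [(hR n).S_mul]
  have hnodeE : ∀ n i, (L (n + 1)).e (m n * i) = (L n).e i := fun n i => (hR n).e_mul i
  let Φ : unitInterval → ℝ → ℝ := fun t x => digitLim K (fun n i => (L n).S i x) t
  let X : unitInterval → ℝ := fun t => digitLim K (fun n i => (L n).e i) t
  have hΦ : ∀ t : unitInterval, ContDiff ℝ ∞ (Φ t) ∧ ∀ k x, iteratedDeriv k (Φ t) x =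
      digitLim K (fun n i => iteratedDeriv k ((L n).S i) x) t := fun t =>
    iteratedDeriv_digitLim (fun n i => (L n).contDiff i) happS t
  have hK : ∀ n, 3 ^ n ≤ K n := by
    intro n
    induction n with
    | zero => exact (L 0).K_pos
    | succ n ih =>
      have h1 : K (n + 1) = m n * K n := (hR n).K_eq
      rw [h1, pow_succ']
      exact Nat.mul_le_mul (hR n).three_le ih
  refine ⟨Φ, X, fun t => (hΦ t).1, fun k => ?_, ?_, fun x t s hts => ?_, ?_, ?_, ?_, ?_,
    fun t => ?_, fun ε hε => ?_⟩
  · refine continuous_uncurry_of_equicontinuous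
      (fun t => (hΦ t).1.continuous_iteratedDeriv k (mod_cast le_top)) fun ε hε => ?_
    obtain ⟨δ, hδ, h⟩ := digitLim_equicontinuous (D := fun n => b n k) (happS k)
      (fun x n i => by
        rw [(L n).iteratedDeriv_succ, add_sub_cancel_left]
        exact hb1 n k i x) (hbs k).tendsto_atTop_zero hε
    refine ⟨δ, hδ, fun t s hts x => ?_⟩
    rw [(hΦ t).2, (hΦ s).2]
    exact h t s t.2.1 s.2.1 hts x
  · rw [Metric.continuous_iff]
    intro s ε hε
    obtain ⟨δ, hδ, h⟩ := digitLim_equicontinuous (X := Unit) (fun _ => happE)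
      (fun _ n i => hmesh n i) hgeom.tendsto_atTop_zero hε
    exact ⟨δ, hδ, fun t hts => h t s t.2.1 s.2.1 hts ()⟩
  · exact (happS0 x).mono (fun n => monotone_nat_of_le_succ fun i => (L n).mono i x) hts
  · funext x
    exact ((happS0 x).zero (hnodeS x)).trans (by rw [(L 0).S_zero])
  · funext x
    exact ((happS0 x).one (hnodeS x)).trans (by rw [(L 0).S_of_le _ le_rfl])
  · exact (happE.zero hnodeE).trans (L 0).e_zero
  · exact (happE.one hnodeE).trans ((L 0).e_of_le _ le_rfl)
  · exact isClosed_Icc.mem_of_tendsto (happE.tendsto t)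
      (Filter.Eventually.of_forall fun n => (L n).e_mem _)
  · have h3 : Filter.Tendsto (fun n : ℕ => ((1 : ℝ) / 3) ^ n) Filter.atTop (nhds 0) :=
      tendsto_pow_atTop_nhds_zero_of_lt_one (by norm_num) (by norm_num)
    obtain ⟨n, h1, h2⟩ := ((h3.eventually (gt_mem_nhds hε)).and
      (hgeom.tendsto_atTop_zero.eventually (gt_mem_nhds hε))).exists
    refine ⟨L n, le_trans ?_ h1.le, fun i => (hmesh n i).trans h2.le, fun t i ht => ⟨?_, ?_⟩⟩
    · rw [one_div, inv_pow]
      refine inv_anti₀ (by positivity) ?_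
      exact_mod_cast hK n
    · funext x
      change digitLim K _ (t : ℝ) = _
      rw [ht]
      exact (happS0 x).eq_at_node (hnodeS x) n i
    · change digitLim K _ (t : ℝ) = _
      rw [ht]
      exact happE.eq_at_node hnodeE n i

/-! ### Smooth functions on a closed interval -/

namespace SmoothFun

variable {a b : ℝ}

theorem ext_of_eqOn {F G : SmoothFun a b} (h : ∀ x ∈ Icc a b, F x = G x) : F = G := by
  have h1 : F.toFun = G.toFun := by
    funext x
    rw [← F.coe_apply, ← G.coe_apply]
    exact h x x.2
  cases F
  cases G
  congr

/-- The restriction to `[a,b]` of a function on the line that is smooth there. -/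
def ofContDiffOn (u : ℝ → ℝ) (hu : ContDiffOn ℝ ∞ u (Icc a b)) : SmoothFun a b where
  toFun x := u x
  contDiffOn' := hu.congr fun x hx =>
    Subtype.val_injective.extend_apply (fun y : Icc a b => u y) 0 ⟨x, hx⟩

theorem ofContDiffOn_apply {u : ℝ → ℝ} (hu : ContDiffOn ℝ ∞ u (Icc a b)) {x : ℝ}
    (hx : x ∈ Icc a b) : ofContDiffOn u hu x = u x :=
  (ofContDiffOn u hu).coe_apply ⟨x, hx⟩

theorem sub_apply (F G : SmoothFun a b) {x : ℝ} (hx : x ∈ Icc a b) : (F - G) x = F x - G x := by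
  rw [show (F - G) x = _ from (F - G).coe_apply ⟨x, hx⟩,
    show F x = _ from F.coe_apply ⟨x, hx⟩, show G x = _ from G.coe_apply ⟨x, hx⟩]
  rfl

theorem contDiffWithinAt (F : SmoothFun a b) (k : ℕ) {x : ℝ} (hx : x ∈ Icc a b) :
    ContDiffWithinAt ℝ k F (Icc a b) x :=
  (F.contDiffOn x hx).of_le (mod_cast le_top)

theorem iterDeriv_sub (hab : a < b) (F G : SmoothFun a b) (k : ℕ) {x : ℝ} (hx : x ∈ Icc a b) :
    (F - G).iterDeriv k x = F.iterDeriv k x - G.iterDeriv k x := by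
  unfold iterDeriv
  rw [← iteratedDerivWithin_sub hx (uniqueDiffOn_Icc hab) (F.contDiffWithinAt k hx)
    (G.contDiffWithinAt k hx)]
  exact iteratedDerivWithin_congr (fun y hy => sub_apply F G hy) hx

theorem continuousOn_iterDeriv (hab : a < b) (F : SmoothFun a b) (k : ℕ) :
    ContinuousOn (F.iterDeriv k) (Icc a b) :=
  F.contDiffOn.continuousOn_iteratedDerivWithin (mod_cast le_top) (uniqueDiffOn_Icc hab)

theorem iterDeriv_zero (F : SmoothFun a b) : F.iterDeriv 0 = F := iteratedDerivWithin_zero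

theorem hasDerivWithinAt (F : SmoothFun a b) {x : ℝ} (hx : x ∈ Icc a b) :
    HasDerivWithinAt F (F.iterDeriv 1 x) (Icc a b) x := by
  have h := (F.contDiffOn.differentiableOn (by simp) x hx).hasDerivWithinAt
  unfold iterDeriv
  rwa [iteratedDerivWithin_one]

/-- A family of smooth functions all of whose derivatives are jointly continuous in the parameter
and the variable is continuous for the `C^∞` topology. -/
theorem continuous_of_continuous_iterDeriv (hab : a < b) {X : Type*} [TopologicalSpace X]
    {F : X → SmoothFun a b}
    (h : ∀ k, Continuous fun p : X × Icc a b => (F p.1).iterDeriv k p.2) : Continuous F := by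
  refine continuous_generateFrom_iff.2 ?_
  rintro _ ⟨G, k, ε, -, rfl⟩
  have hck : Continuous fun t => ckNorm k (F t - G) := by
    unfold ckNorm
    refine Continuous.finset_sup'_apply _ fun i _ => ?_
    have h1 : Continuous fun p : X × Icc a b => |(F p.1 - G).iterDeriv i p.2| := by
      simp only [fun p : X × Icc a b => iterDeriv_sub hab (F p.1) G i p.2.2]
      exact ((h i).sub
        ((continuousOn_iff_continuous_domRestrict.1 (G.continuousOn_iterDeriv hab i)).comp
          continuous_snd)).abs
    have h2 := isCompact_univ.continuous_sSup
      (f := fun (t : X) (x : Icc a b) => |(F t - G).iterDeriv i x|) h1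
    simpa only [image_univ, sSup_range] using h2
  exact isOpen_lt hck continuous_const

end SmoothFun

/-! ### Lunes -/

theorem isOpen_between {s : Set ℝ} (hs : IsOpen s) {u v : ℝ → ℝ} (hu : ContinuousOn u s)
    (hv : ContinuousOn v s) : IsOpen {p : ℝ × ℝ | p.1 ∈ s ∧ u p.1 < p.2 ∧ p.2 < v p.1} := by
  have hs' : IsOpen (s ×ˢ (univ : Set ℝ)) := hs.prod isOpen_univ
  have hm : MapsTo Prod.fst (s ×ˢ (univ : Set ℝ)) s := fun p hp => hp.1
  have h := ((continuousOn_snd.sub (hu.comp continuousOn_fst hm)).prodMk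
    ((hv.comp continuousOn_fst hm).sub continuousOn_snd)).isOpen_inter_preimage hs'
    ((isOpen_Ioi (a := (0 : ℝ))).prod (isOpen_Ioi (a := (0 : ℝ))))
  convert h using 1
  ext p
  simp

theorem lt_of_mem_interior_lune {a b : ℝ} {f g : SmoothFun a b} {p : ℝ × ℝ}
    (hp : p ∈ interior (lune f g)) : p.1 ∈ Icc a b ∧ f p.1 < p.2 ∧ p.2 < g p.1 := by
  refine ⟨(interior_subset hp).1, ?_⟩
  have h1 : p.2 ∈ interior ((fun y => (p.1, y)) ⁻¹' lune f g) :=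
    preimage_interior_subset_interior_preimage (by fun_prop) hp
  have h2 : (fun y => (p.1, y)) ⁻¹' lune f g ⊆ Icc (f p.1) (g p.1) := fun y hy => hy.2
  have h3 := interior_mono h2 h1
  rwa [interior_Icc] at h3

/-- The support of a simple lune is an open interval, since `f` and `g` agree at `a` and `b`. -/
theorem IsSimpleLune.exists_support_eq {a b : ℝ} {f g : SmoothFun a b} (h : IsSimpleLune f g) :
    ∃ c d, a ≤ c ∧ c < d ∧ d ≤ b ∧ luneSupport f g = Ioo c d := by
  have hS : luneSupport f g = {x | x ∈ Ioo a b ∧ f x < g x} := by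
    have ha := h.deriv_left 0
    have hb := h.deriv_right 0
    rw [SmoothFun.iterDeriv_zero, SmoothFun.iterDeriv_zero] at ha hb
    ext x
    refine ⟨fun hx => ⟨⟨hx.1.1.lt_of_ne ?_, hx.1.2.lt_of_ne ?_⟩, hx.2⟩,
      fun hx => ⟨Ioo_subset_Icc_self hx.1, hx.2⟩⟩
    · rintro rfl; exact hx.2.ne ha
    · rintro rfl; exact hx.2.ne hb
  have hopen : IsOpen (luneSupport f g) := by
    have := ((g.contDiffOn.continuousOn.sub f.contDiffOn.continuousOn).mono
      (Ioo_subset_Icc_self (a := a) (b := b))).isOpen_inter_preimage isOpen_Ioo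
      (isOpen_Ioi (a := (0 : ℝ)))
    rw [hS]
    convert this using 1
    ext x
    simp
  have hsub : luneSupport f g ⊆ Icc a b := fun x hx => hx.1
  have hbb : BddBelow (luneSupport f g) := bddBelow_Icc.mono hsub
  have hba : BddAbove (luneSupport f g) := bddAbove_Icc.mono hsub
  have heq : luneSupport f g = Ioo (sInf (luneSupport f g)) (sSup (luneSupport f g)) := by
    apply Subset.antisymm
    · intro x hx
      obtain ⟨ε, hε, hball⟩ := Metric.isOpen_iff.1 hopen x hx
      rw [Real.ball_eq_Ioo] at hball
      have h1 := csInf_le hbb (hball (show x - ε / 2 ∈ _ from ⟨by linarith, by linarith⟩))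
      have h2 := le_csSup hba (hball (show x + ε / 2 ∈ _ from ⟨by linarith, by linarith⟩))
      exact ⟨by linarith, by linarith⟩
    · rintro x ⟨h1, h2⟩
      obtain ⟨s, hs, hsx⟩ := exists_lt_of_csInf_lt h.support_nonempty h1
      obtain ⟨s', hs', hsx'⟩ := exists_lt_of_lt_csSup h.support_nonempty h2
      exact h.support_ordConnected.out hs hs' ⟨hsx.le, hsx'.le⟩
  refine ⟨_, _, le_csInf h.support_nonempty fun x hx => hx.1.1, ?_,
    csSup_le h.support_nonempty fun x hx => hx.1.2, heq⟩
  have h1 := h.support_nonempty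
  rw [heq] at h1
  obtain ⟨x, hx⟩ := h1
  exact hx.1.trans hx.2

/-- The smooth function `f + (g - f) φ`. -/
def interpolate {a b : ℝ} (f g : SmoothFun a b) (φ : ℝ → ℝ) (hφ : ContDiff ℝ ∞ φ) :
    SmoothFun a b :=
  SmoothFun.ofContDiffOn (fun x => f x + (g x - f x) * φ x)
    (f.contDiffOn.add ((g.contDiffOn.sub f.contDiffOn).mul hφ.contDiffOn))

theorem interpolate_apply {a b : ℝ} (f g : SmoothFun a b) {φ : ℝ → ℝ} (hφ : ContDiff ℝ ∞ φ)
    {x : ℝ} (hx : x ∈ Icc a b) : interpolate f g φ hφ x = f x + (g x - f x) * φ x :=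
  SmoothFun.ofContDiffOn_apply _ hx

theorem iterDeriv_interpolate {a b : ℝ} (hab : a < b) (f g : SmoothFun a b) {φ : ℝ → ℝ}
    (hφ : ContDiff ℝ ∞ φ) (k : ℕ) {x : ℝ} (hx : x ∈ Icc a b) :
    (interpolate f g φ hφ).iterDeriv k x = f.iterDeriv k x + ∑ i ∈ Finset.range (k + 1),
      k.choose i * (g - f).iterDeriv i x * iteratedDeriv (k - i) φ x := by
  have hu := uniqueDiffOn_Icc hab
  have hφk : ∀ k : ℕ, ContDiff ℝ k φ := fun k => hφ.of_le (mod_cast le_top)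
  have hw := ((hφk k).contDiffAt (x := x)).contDiffWithinAt (s := Icc a b)
  have h1 : (interpolate f g φ hφ).iterDeriv k x =
      iteratedDerivWithin k (fun y => f y + ((g - f : SmoothFun a b) * φ : ℝ → ℝ) y)
        (Icc a b) x := by
    refine iteratedDerivWithin_congr (fun y hy => ?_) hx
    rw [interpolate_apply f g hφ hy, Pi.mul_apply, SmoothFun.sub_apply g f hy]
  have hprod : ContDiffWithinAt ℝ k ((g - f : SmoothFun a b) * φ : ℝ → ℝ) (Icc a b) x :=
    ((g - f).contDiffWithinAt k hx).mul hw
  rw [h1, iteratedDerivWithin_fun_add hx hu (f.contDiffWithinAt k hx) hprod,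
    iteratedDerivWithin_mul hx hu ((g - f).contDiffWithinAt k hx) hw]
  congr 1
  refine Finset.sum_congr rfl fun i _ => ?_
  rw [iteratedDerivWithin_eq_iteratedDeriv hu (hφk _).contDiffAt hx]
  rfl

theorem IsLune.interpolate {a b : ℝ} (hab : a < b) {f g : SmoothFun a b} (h : IsLune f g)
    {φ : ℝ → ℝ} (hφ : ContDiff ℝ ∞ φ) (h0 : ∀ x, 0 ≤ φ x) :
    IsLune f (interpolate f g φ hφ) where
  deriv_left k := by
    have ha := left_mem_Icc.2 hab.le
    rw [iterDeriv_interpolate hab f g hφ k ha, left_eq_add]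
    refine Finset.sum_eq_zero fun i _ => ?_
    rw [SmoothFun.iterDeriv_sub hab g f i ha, h.deriv_left i, sub_self, mul_zero, zero_mul]
  deriv_right k := by
    have hb := right_mem_Icc.2 hab.le
    rw [iterDeriv_interpolate hab f g hφ k hb, left_eq_add]
    refine Finset.sum_eq_zero fun i _ => ?_
    rw [SmoothFun.iterDeriv_sub hab g f i hb, h.deriv_right i, sub_self, mul_zero, zero_mul]
  le x hx := by
    rw [interpolate_apply f g hφ hx]
    have := mul_nonneg (sub_nonneg.2 (h.le x hx)) (h0 x)
    linarith

/-- Two ordered smooth functions that meet at `x` have the same derivative there. -/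
theorem iterDeriv_one_eq_of_eq {a b : ℝ} {F G : SmoothFun a b} (h : IsLune F G) {x : ℝ}
    (hx : x ∈ Icc a b) (he : F x = G x) : F.iterDeriv 1 x = G.iterDeriv 1 x := by
  rcases hx.1.eq_or_lt with rfl | h1
  · exact h.deriv_left 1
  rcases hx.2.eq_or_lt with rfl | h2
  · exact h.deriv_right 1
  have hmem := Icc_mem_nhds h1 h2
  have hF := (F.hasDerivWithinAt hx).hasDerivAt hmem
  have hG := (G.hasDerivWithinAt hx).hasDerivAt hmem
  have hmin : IsLocalMin (fun y => G y - F y) x := by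
    filter_upwards [hmem] with y hy
    have := h.le y hy
    linarith
  linarith [hmin.hasDerivAt_eq_zero (hG.sub hF)]

/-! ### Sweeping out a lune -/

/-- The sweep `Φ` of a bump function that is `1` on `[a,b]`, transported to a lune whose support is
`(c, d)`. -/
structure IsLuneSweep {a b : ℝ} (f g : SmoothFun a b) (c d : ℝ) (Φ : unitInterval → ℝ → ℝ)
    (X : unitInterval → ℝ) : Prop where
  lune : IsLune f g
  lt : c < d
  left : a ≤ c
  right : d ≤ b
  support : luneSupport f g = Ioo c d
  sweep : ∃ β, (∀ x ∈ Icc a b, β x = 1) ∧ IsSweep c d β Φ X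

namespace IsLuneSweep

variable {a b : ℝ} {f g : SmoothFun a b} {c d : ℝ} {Φ : unitInterval → ℝ → ℝ}
  {X : unitInterval → ℝ}

theorem hab (h : IsLuneSweep f g c d Φ X) : a < b := h.left.trans_lt (h.lt.trans_le h.right)

theorem contDiff (h : IsLuneSweep f g c d Φ X) (t : unitInterval) : ContDiff ℝ ∞ (Φ t) := by
  obtain ⟨β, -, hs⟩ := h.sweep
  exact hs.contDiff t

/-- The moving upper boundary of the swept region. -/
def front (h : IsLuneSweep f g c d Φ X) (t : unitInterval) : SmoothFun a b :=
  interpolate f g (Φ t) (h.contDiff t)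

variable (h : IsLuneSweep f g c d Φ X)

include h

theorem pos_mem (t : unitInterval) : X t ∈ Icc a b := by
  obtain ⟨β, -, hs⟩ := h.sweep
  exact Icc_subset_Icc h.left h.right (hs.mem t)

theorem front_apply (t : unitInterval) {x : ℝ} (hx : x ∈ Icc a b) :
    h.front t x = f x + (g x - f x) * Φ t x :=
  interpolate_apply f g (h.contDiff t) hx

theorem nonneg (t : unitInterval) (x : ℝ) : 0 ≤ Φ t x := by
  obtain ⟨β, -, hs⟩ := h.sweep
  have := hs.mono x (unitInterval.nonneg' (t := t))
  simpa only [hs.zero] using this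

theorem isLune_front (t : unitInterval) : IsLune f (h.front t) :=
  h.lune.interpolate h.hab (h.contDiff t) (h.nonneg t)

theorem front_zero : h.front 0 = f := by
  obtain ⟨β, -, hs⟩ := h.sweep
  refine SmoothFun.ext_of_eqOn fun x hx => ?_
  rw [h.front_apply 0 hx, hs.zero, mul_zero, add_zero]

theorem front_one : h.front 1 = g := by
  obtain ⟨β, hβ, hs⟩ := h.sweep
  refine SmoothFun.ext_of_eqOn fun x hx => ?_
  rw [h.front_apply 1 hx, hs.one, hβ x hx]
  ring

theorem front_mono {t s : unitInterval} (hts : t ≤ s) {x : ℝ} (hx : x ∈ Icc a b) :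
    h.front t x ≤ h.front s x := by
  obtain ⟨β, -, hs⟩ := h.sweep
  rw [h.front_apply t hx, h.front_apply s hx]
  have h1 := mul_le_mul_of_nonneg_left (hs.mono x hts) (sub_nonneg.2 (h.lune.le x hx))
  simp only at h1
  linarith

theorem isLune_front_front {t s : unitInterval} (hts : t ≤ s) : IsLune (h.front t) (h.front s) where
  deriv_left k := ((h.isLune_front t).deriv_left k).symm.trans ((h.isLune_front s).deriv_left k)
  deriv_right k := ((h.isLune_front t).deriv_right k).symm.trans ((h.isLune_front s).deriv_right k)
  le _ hx := h.front_mono hts hx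

theorem front_mem (t : unitInterval) {x : ℝ} (hx : x ∈ Icc a b) :
    (x, h.front t x) ∈ _root_.lune f g := by
  refine ⟨hx, (h.isLune_front t).le x hx, ?_⟩
  have := h.front_mono (unitInterval.le_one' (t := t)) hx
  rwa [h.front_one] at this

theorem continuous_iterDeriv_front (k : ℕ) :
    Continuous fun p : unitInterval × Icc a b => (h.front p.1).iterDeriv k p.2 := by
  obtain ⟨β, -, hs⟩ := h.sweep
  have hx : ∀ (F : SmoothFun a b) (i : ℕ),
      Continuous fun p : unitInterval × Icc a b => F.iterDeriv i p.2 := fun F i =>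
    (continuousOn_iff_continuous_domRestrict.1 (F.continuousOn_iterDeriv h.hab i)).comp
      continuous_snd
  have heq : (fun p : unitInterval × Icc a b => (h.front p.1).iterDeriv k p.2) = fun p =>
      f.iterDeriv k p.2 + ∑ i ∈ Finset.range (k + 1),
        k.choose i * (g - f).iterDeriv i p.2 * iteratedDeriv (k - i) (Φ p.1) p.2 := by
    funext p
    exact iterDeriv_interpolate h.hab f g (h.contDiff p.1) k p.2.2
  rw [heq]
  refine (hx f k).add (continuous_finsetSum _ fun i _ => ?_)
  refine (continuous_const.mul (hx (g - f) i)).mul ?_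
  exact (hs.continuous_iteratedDeriv (k - i)).comp
    (continuous_fst.prodMk (continuous_subtype_val.comp continuous_snd))

theorem continuous_front : Continuous h.front :=
  SmoothFun.continuous_of_continuous_iterDeriv h.hab h.continuous_iterDeriv_front

theorem continuous_uncurry_front :
    Continuous fun p : unitInterval × Icc a b => h.front p.1 p.2 := by
  simpa only [SmoothFun.iterDeriv_zero] using h.continuous_iterDeriv_front 0

theorem continuous_front_apply {x : ℝ} (hx : x ∈ Icc a b) : Continuous fun t => h.front t x :=
  h.continuous_uncurry_front.comp (g := fun p : unitInterval × Icc a b => h.front p.1 p.2)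
    (f := fun t => (t, ⟨x, hx⟩)) (continuous_id.prodMk continuous_const)

/-- The curve tracing out the lune: the point of the front above the current position. -/
def curve (t : unitInterval) : ℝ × ℝ := (X t, h.front t (X t))

theorem curve_mem (t : unitInterval) : h.curve t ∈ _root_.lune f g := h.front_mem t (h.pos_mem t)

theorem continuous_pos : Continuous X := by
  obtain ⟨β, -, hs⟩ := h.sweep
  exact hs.continuous_pos

theorem continuous_curve : Continuous h.curve :=
  h.continuous_pos.prodMk (h.continuous_uncurry_front.comp
    (continuous_id.prodMk (h.continuous_pos.subtype_mk h.pos_mem)))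

theorem eq_of_notMem {x : ℝ} (hx : x ∈ Icc a b) (hx' : x ∉ Ioo c d) : g x = f x := by
  rw [← h.support] at hx'
  exact ((h.lune.le x hx).antisymm (not_lt.1 fun h1 => hx' ⟨hx, h1⟩)).symm

/-- Every interior point `p` of the region below the front at time `t` has been visited: at the
fine scales, `p` lies in some piece, which is swept out close to `p`; pass to the limit. -/
theorem interior_subset_image (t : unitInterval) :
    interior (_root_.lune f (h.front t)) ⊆ h.curve '' Icc 0 t := by
  obtain ⟨β, hβ, hs⟩ := h.sweep
  rintro ⟨x, y⟩ hp
  obtain ⟨hx, h1, h2⟩ := lt_of_mem_interior_lune hp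
  simp only at hx h1 h2
  have hyg : y < g x := h2.trans_le (h.front_mem t hx).2.2
  have hxcd : x ∈ Ioo c d := by
    rw [← h.support]
    exact ⟨hx, h1.trans hyg⟩
  have key : ∀ n : ℕ, ∃ s s' : unitInterval, s ∈ Icc 0 t ∧ dist s s' ≤ 1 / ((n : ℝ) + 1) ∧
      h.front s x ≤ y ∧ y < h.front s' x ∧ |X s - x| ≤ 1 / ((n : ℝ) + 1) := by
    intro n
    obtain ⟨L, hK, hmesh, hnode⟩ := hs.exists_stack (1 / ((n : ℝ) + 1)) (by positivity)
    have hKpos : (0 : ℝ) < L.K := by exact_mod_cast L.K_pos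
    have hex : ∃ i, y < f x + (g x - f x) * L.S i x :=
      ⟨L.K, by rw [L.S_of_le _ le_rfl, hβ x hx]; linarith⟩
    classical
    have hspec := Nat.find_spec hex
    have hmin : ∀ {i}, i < Nat.find hex → ¬ y < f x + (g x - f x) * L.S i x := Nat.find_min hex
    have hle : Nat.find hex ≤ L.K :=
      Nat.find_min' hex (by rw [L.S_of_le _ le_rfl, hβ x hx]; linarith)
    rcases hfind : Nat.find hex with _ | i
    · rw [hfind, L.S_zero] at hspec
      linarith
    · rw [hfind] at hspec hle hmin
      have hi := not_lt.1 (hmin (Nat.lt_succ_self i))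
      have hmem : ∀ j : ℕ, j ≤ L.K → ((j : ℝ) / L.K) ∈ unitInterval := fun j hj =>
        ⟨by positivity, (div_le_one hKpos).2 (by exact_mod_cast hj)⟩
      let s : unitInterval := ⟨(i : ℝ) / L.K, hmem i (by omega)⟩
      let s' : unitInterval := ⟨((i + 1 : ℕ) : ℝ) / L.K, hmem (i + 1) hle⟩
      have hs1 : h.front s x ≤ y := by
        rw [h.front_apply s hx, (hnode s i rfl).1]
        exact hi
      have hs2 : y < h.front s' x := by
        rw [h.front_apply s' hx, (hnode s' (i + 1) rfl).1]
        exact hspec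
      refine ⟨s, s', ⟨unitInterval.nonneg', ?_⟩, ?_, hs1, hs2, ?_⟩
      · by_contra hts
        have := h.front_mono (not_le.1 hts).le hx
        linarith
      · rw [Subtype.dist_eq, Real.dist_eq]
        refine le_trans (le_of_eq ?_) hK
        simp only [s, s']
        push_cast
        rw [← sub_div, abs_div, abs_of_pos hKpos, sub_add_cancel_left, abs_neg, abs_one, one_div]
      · rw [(hnode s i rfl).2]
        have hlt : L.S i x < L.S (i + 1) x := by
          have := hi.trans_lt hspec
          have hpos : 0 < g x - f x := by linarith
          rw [add_lt_add_iff_left] at this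
          exact lt_of_mul_lt_mul_left this hpos.le
        have hneg := (L.lt_iff i x hxcd).1 hlt
        refine le_trans ?_ (hmesh i)
        rcases mul_neg_iff.1 hneg with ⟨ha, hb⟩ | ⟨ha, hb⟩
        · rw [abs_of_nonpos (by linarith), abs_of_nonneg (by linarith)]; linarith
        · rw [abs_of_nonneg (by linarith), abs_of_nonpos (by linarith)]; linarith
  choose s s' hst hss' hsy hys' hXs using key
  obtain ⟨r, hr, φ, hφ, hlim⟩ := isCompact_Icc.tendsto_subseq hst
  have h0 : Filter.Tendsto (fun n => 1 / (((φ n : ℕ) : ℝ) + 1)) Filter.atTop (nhds 0) :=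
    tendsto_one_div_add_atTop_nhds_zero_nat.comp hφ.tendsto_atTop
  have hlim' : Filter.Tendsto (s' ∘ φ) Filter.atTop (nhds r) :=
    tendsto_of_tendsto_of_dist hlim (squeeze_zero (fun _ => dist_nonneg) (fun n => hss' (φ n)) h0)
  have hXr : X r = x := by
    refine tendsto_nhds_unique ((h.continuous_pos.tendsto r).comp hlim) ?_
    rw [tendsto_iff_dist_tendsto_zero]
    exact squeeze_zero (fun _ => dist_nonneg) (fun n => hXs (φ n)) h0
  have hc := (h.continuous_front_apply hx).tendsto r
  have hFr : h.front r x = y := le_antisymm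
    (le_of_tendsto' (hc.comp hlim) fun n => hsy (φ n))
    (ge_of_tendsto' (hc.comp hlim') fun n => (hys' (φ n)).le)
  exact ⟨r, hr, by rw [curve, hXr, hFr]⟩

/-- The region strictly between two fronts lies in the interior of the region below the later. -/
theorem mem_interior_of_between {r s t : unitInterval} (hst : s ≤ t) {p : ℝ × ℝ}
    (hp : p.1 ∈ Ioo c d) (h1 : h.front r p.1 < p.2) (h2 : p.2 < h.front s p.1) :
    p ∈ interior (_root_.lune f (h.front t)) := by
  have hsub : Ioo c d ⊆ Icc a b := Ioo_subset_Icc_self.trans (Icc_subset_Icc h.left h.right)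
  refine mem_interior.2 ⟨_, ?_, isOpen_between isOpen_Ioo
    ((h.front r).contDiffOn.continuousOn.mono hsub)
    ((h.front s).contDiffOn.continuousOn.mono hsub), ⟨hp, h1, h2⟩⟩
  rintro q ⟨hq, hq1, hq2⟩
  exact ⟨hsub hq, ((h.isLune_front r).le _ (hsub hq)).trans hq1.le,
    hq2.le.trans (h.front_mono hst (hsub hq))⟩

/-- When the curve enters a piece that is swept out before time `t`, it is in the closure of the
interior of this piece. -/
theorem curve_node_mem {β : ℝ → ℝ} {L : Stack c d β} {s s' t : unitInterval} {i : ℕ}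
    (hi : i < L.K) (hs : Φ s = L.S i) (hX : X s = L.e i) (hs' : Φ s' = L.S (i + 1))
    (hst : s' ≤ t) : h.curve s ∈ essLune f (h.front t) := by
  set u := L.e i
  set v := L.e (i + 1)
  have hne : v - u ≠ 0 := sub_ne_zero.2 (L.e_ne i hi).symm
  have hu : u ∈ Icc a b := hX ▸ h.pos_mem s
  have hmeet : h.front s u = h.front s' u := by
    rw [h.front_apply s hu, h.front_apply s' hu, hs, hs']
    by_cases hucd : u ∈ Ioo c d
    · have h1 : ¬ L.S i u < L.S (i + 1) u := by
        rw [L.lt_iff i u hucd, sub_self, zero_mul]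
        exact lt_irrefl _
      rw [le_antisymm (L.mono i u) (not_lt.1 h1)]
    · rw [h.eq_of_notMem hu hucd, sub_self, zero_mul, zero_mul]
  -- approach the entry point along the piece, halfway between its lower and upper boundary
  let ξ : ℝ → ℝ := fun θ => u + θ * (v - u)
  have hξ0 : Filter.Tendsto ξ (nhdsWithin 0 (Ioi 0)) (nhds u) := by
    have : Continuous ξ := by fun_prop
    have h2 := this.tendsto 0
    simp only [ξ, zero_mul, add_zero] at h2
    exact h2.mono_left nhdsWithin_le_nhds
  have hξ : ∀ θ ∈ Ioo (0 : ℝ) 1, ξ θ ∈ Ioo c d ∧ (ξ θ - u) * (ξ θ - v) < 0 := by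
    rintro θ ⟨h0, h1⟩
    have hneg : (ξ θ - u) * (ξ θ - v) < 0 := by
      rw [show (ξ θ - u) * (ξ θ - v) = -(θ * (1 - θ) * (v - u) ^ 2) by simp only [ξ]; ring]
      have : 0 < (v - u) ^ 2 := by positivity
      have := mul_pos (mul_pos h0 (sub_pos.2 h1)) this
      linarith
    have hu' := L.e_mem i
    have hv' := L.e_mem (i + 1)
    refine ⟨?_, hneg⟩
    rcases mul_neg_iff.1 hneg with ⟨ha, hb⟩ | ⟨ha, hb⟩
    · exact ⟨by linarith [hu'.1], by linarith [hv'.2]⟩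
    · exact ⟨by linarith [hv'.1], by linarith [hu'.2]⟩
  have hev : ∀ᶠ θ in nhdsWithin (0 : ℝ) (Ioi 0), θ ∈ Ioo (0 : ℝ) 1 :=
    Ioo_mem_nhdsGT one_pos
  have hsub : Ioo c d ⊆ Icc a b := Ioo_subset_Icc_self.trans (Icc_subset_Icc h.left h.right)
  have hξw : Filter.Tendsto ξ (nhdsWithin 0 (Ioi 0)) (nhdsWithin u (Icc a b)) :=
    tendsto_nhdsWithin_iff.2 ⟨hξ0, hev.mono fun θ hθ => hsub (hξ θ hθ).1⟩
  have hF : ∀ r : unitInterval,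
      Filter.Tendsto (fun θ => h.front r (ξ θ)) (nhdsWithin 0 (Ioi 0)) (nhds (h.front r u)) :=
    fun r => ((h.front r).contDiffOn.continuousOn u hu).tendsto.comp hξw
  have hlim := hξ0.prodMk_nhds (((hF s).add (hF s')).div_const 2)
  have hval : (u, (h.front s u + h.front s' u) / 2) = h.curve s := by
    rw [curve, hX, ← hmeet, add_self_div_two]
  rw [hval] at hlim
  refine mem_closure_of_tendsto hlim (hev.mono fun θ hθ => ?_)
  obtain ⟨hcd, hneg⟩ := hξ θ hθ
  have hlt : h.front s (ξ θ) < h.front s' (ξ θ) := by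
    rw [h.front_apply s (hsub hcd), h.front_apply s' (hsub hcd), hs, hs', add_lt_add_iff_left]
    have hpos : f (ξ θ) < g (ξ θ) := by
      rw [← h.support] at hcd
      exact hcd.2
    exact mul_lt_mul_of_pos_left ((L.lt_iff i _ hcd).2 hneg) (sub_pos.2 hpos)
  exact h.mem_interior_of_between (r := s) (s := s') hst hcd (by simp only; linarith)
    (by simp only; linarith)

theorem curve_mem_essLune {s t : unitInterval} (hst : s ≤ t) (ht : 0 < t) :
    h.curve s ∈ essLune f (h.front t) := by
  obtain ⟨β, -, hs⟩ := h.sweep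
  have hclosed : IsClosed (h.curve ⁻¹' essLune f (h.front t)) :=
    isClosed_closure.preimage h.continuous_curve
  change s ∈ h.curve ⁻¹' essLune f (h.front t)
  rw [← hclosed.closure_eq, Metric.mem_closure_iff]
  intro ε hε
  have ht0 : (0 : ℝ) < t := ht
  have hst' : (s : ℝ) ≤ t := hst
  have hs0 : (0 : ℝ) ≤ s := s.2.1
  have ht1 : (t : ℝ) ≤ 1 := t.2.2
  set η := min (ε / 4) (t : ℝ) with hη
  have hη0 : 0 < η := lt_min (by linarith) ht0
  have hη1 : η ≤ ε / 4 := min_le_left _ _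
  have hη2 : η ≤ t := min_le_right _ _
  obtain ⟨L, hK, -, hnode⟩ := hs.exists_stack η hη0
  have hKpos : (0 : ℝ) < L.K := by exact_mod_cast L.K_pos
  -- the node at the left end of the cell of a time slightly before `s`, so that the whole cell
  -- has been swept at time `t`
  set r := max 0 ((s : ℝ) - η) with hr
  have hr0 : 0 ≤ r := le_max_left _ _
  have hrs : r ≤ s := max_le hs0 (by linarith)
  have hrs' : (s : ℝ) - η ≤ r := le_max_right _ _
  have hrt : r + η ≤ t := by
    rcases max_choice 0 ((s : ℝ) - η) with h1 | h1 <;> rw [hr, h1] <;> linarith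
  set i := ⌊L.K * r⌋₊ with hidef
  have hi1 : (i : ℝ) / L.K ≤ r := by
    rw [div_le_iff₀ hKpos, mul_comm]
    exact Nat.floor_le (by positivity)
  have hi2 : r < ((i + 1 : ℕ) : ℝ) / L.K := by
    rw [lt_div_iff₀ hKpos, mul_comm]
    exact_mod_cast Nat.lt_floor_add_one _
  have hi3 : ((i + 1 : ℕ) : ℝ) / L.K = (i : ℝ) / L.K + (L.K : ℝ)⁻¹ := by
    push_cast
    rw [add_div, one_div]
  have hi4 : ((i + 1 : ℕ) : ℝ) / L.K ≤ t := by linarith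
  have hiK : i < L.K := by
    have := hi4.trans ht1
    rw [div_le_one hKpos] at this
    have : i + 1 ≤ L.K := by exact_mod_cast this
    omega
  have hi0 : 0 ≤ (i : ℝ) / L.K := by positivity
  let s₁ : unitInterval := ⟨(i : ℝ) / L.K, hi0, by linarith [s.2.2]⟩
  let s₂ : unitInterval := ⟨((i + 1 : ℕ) : ℝ) / L.K, by positivity, hi4.trans ht1⟩
  refine ⟨s₁, h.curve_node_mem hiK (hnode s₁ i rfl).1 (hnode s₁ i rfl).2 (hnode s₂ (i + 1) rfl).1
    hi4, ?_⟩
  rw [Subtype.dist_eq, Real.dist_eq, abs_of_nonneg (by simp only [s₁]; linarith)]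
  simp only [s₁]
  linarith

theorem image_curve {t : unitInterval} (ht : 0 < t) :
    h.curve '' Icc 0 t = essLune f (h.front t) := by
  apply Subset.antisymm
  · rintro _ ⟨s, hs, rfl⟩
    exact h.curve_mem_essLune hs.2 ht
  · exact closure_minimal (h.interior_subset_image t)
      (isCompact_Icc.image h.continuous_curve).isClosed

theorem isPeanoCurve : IsPeanoCurve h.curve := by
  refine ⟨h.continuous_curve, ?_⟩
  have hm : (c + d) / 2 ∈ Ioo c d := ⟨by linarith [h.lt], by linarith [h.lt]⟩
  have hfg : f ((c + d) / 2) < g ((c + d) / 2) := by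
    rw [← h.support] at hm
    exact hm.2
  have hp : ((c + d) / 2, (f ((c + d) / 2) + g ((c + d) / 2)) / 2) ∈
      interior (_root_.lune f (h.front 1)) := by
    refine h.mem_interior_of_between (r := 0) (s := 1) le_rfl hm ?_ ?_
    · rw [h.front_zero]; simp only; linarith
    · rw [h.front_one]; simp only; linarith
  refine ⟨_, interior_maximal ?_ isOpen_interior hp⟩
  exact (h.interior_subset_image 1).trans (image_subset_range _ _)

/-- The slopes of the fronts define a continuous function on the lune, because
`(t, x) ↦ (x, front t x)` is a quotient map of compact spaces onto it. -/
theorem exists_slope : ∃ ψ : _root_.lune f g → ℝ, Continuous ψ ∧ ∀ (t : unitInterval) (x : ℝ)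
    (hx : x ∈ Icc a b), ψ ⟨(x, h.front t x), h.front_mem t hx⟩ = (h.front t).iterDeriv 1 x := by
  let q : unitInterval × Icc a b → _root_.lune f g :=
    fun p => ⟨((p.2 : ℝ), h.front p.1 p.2), h.front_mem p.1 p.2.2⟩
  have hq : Continuous q := ((continuous_subtype_val.comp continuous_snd).prodMk
    h.continuous_uncurry_front).subtype_mk _
  have hsurj : Function.Surjective q := by
    rintro ⟨⟨x, y⟩, hx, hy1, hy2⟩
    simp only at hx hy1 hy2
    have hivt := intermediate_value_univ (0 : unitInterval) 1 (h.continuous_front_apply hx)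
    rw [h.front_zero, h.front_one] at hivt
    obtain ⟨t, ht⟩ := hivt ⟨hy1, hy2⟩
    exact ⟨(t, ⟨x, hx⟩), Subtype.ext (Prod.ext rfl ht)⟩
  have hquot : Topology.IsQuotientMap q := hq.isClosedMap.isQuotientMap hq hsurj
  have hD : ∀ p p', q p = q p' →
      (h.front p.1).iterDeriv 1 p.2 = (h.front p'.1).iterDeriv 1 p'.2 := by
    rintro ⟨t, x⟩ ⟨s, y⟩ hpq
    obtain ⟨h1, h2⟩ := Prod.ext_iff.1 (Subtype.ext_iff.1 hpq)
    obtain rfl : x = y := Subtype.ext h1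
    rcases le_total t s with hts | hts
    · exact iterDeriv_one_eq_of_eq (h.isLune_front_front hts) x.2 h2
    · exact (iterDeriv_one_eq_of_eq (h.isLune_front_front hts) x.2 h2.symm).symm
  let ψ : _root_.lune f g → ℝ := fun z =>
    (h.front (Function.surjInv hsurj z).1).iterDeriv 1 (Function.surjInv hsurj z).2
  have hψ : ∀ p, ψ (q p) = (h.front p.1).iterDeriv 1 p.2 := fun p =>
    hD _ _ (Function.surjInv_eq hsurj (q p))
  refine ⟨ψ, ?_, fun t x hx => hψ (t, ⟨x, hx⟩)⟩
  rw [hquot.continuous_iff, show ψ ∘ q = _ from funext hψ]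
  exact h.continuous_iterDeriv_front 1

end IsLuneSweep

theorem IsSimpleLune.exists_isLuneSweep {a b : ℝ} {f g : SmoothFun a b} (h : IsSimpleLune f g) :
    ∃ c d Φ X, IsLuneSweep f g c d Φ X := by
  obtain ⟨c, d, hac, hcd, hdb, hS⟩ := h.exists_support_eq
  have hab : a < b := by linarith
  let β : ContDiffBump ((a + b) / 2) := ⟨(b - a) / 2, b - a, by linarith, by linarith⟩
  have hβ1 : ∀ x ∈ Icc a b, β x = 1 := fun x hx => by
    refine β.one_of_mem_closedBall ?_
    rw [Real.closedBall_eq_Icc]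
    exact ⟨by simp only [β]; linarith [hx.1], by simp only [β]; linarith [hx.2]⟩
  obtain ⟨Φ, X, hs⟩ := exists_isSweep (Stack.single hcd β.contDiff β.hasCompactSupport
    (fun _ => β.nonneg) fun x hx => by
      rw [hβ1 x ⟨by linarith [hx.1], by linarith [hx.2]⟩]; exact one_pos)
  exact ⟨c, d, Φ, X, h.toIsLune, hcd, hac, hdb, hS, β, hβ1, hs⟩

end

theorem mainTheorem2 (a b : ℝ) (f g : SmoothFun a b) (hL : IsSimpleLune f g) :
    ∃ c d : ℝ, a ≤ c ∧ c < d ∧ d ≤ b ∧ luneSupport f g = Set.Ioo c d ∧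
      ∃ (γ : unitInterval → lune f g) (F : unitInterval → SmoothFun a b) (ψ : lune f g → ℝ),
        IsPeanoCurve (fun t => (γ t : ℝ × ℝ)) ∧ Continuous F ∧ Continuous ψ ∧
        (F 0 = f ∧ F 1 = g) ∧
        (∀ t s : unitInterval, t ≤ s → ∀ x ∈ Set.Icc a b, F t x ≤ F s x) ∧
        (∀ t : unitInterval, (γ t : ℝ × ℝ).2 = F t (γ t : ℝ × ℝ).1) ∧
        (∀ t : unitInterval, ∀ x ∈ Set.Icc a b, ∃ h : (x, F t x) ∈ lune f g,
          HasDerivWithinAt (F t) (ψ ⟨(x, F t x), h⟩) (Set.Icc a b) x) ∧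
        (∀ t : unitInterval, 0 < t → IsLune f (F t) ∧
          (fun s => (γ s : ℝ × ℝ)) '' Set.Icc 0 t = essLune f (F t)) ∧
        ((γ 0 : ℝ × ℝ) = (c, f c) ∧ (γ 1 : ℝ × ℝ) = (d, f d)) := by
  obtain ⟨c, d, Φ, X, h⟩ := hL.exists_isLuneSweep
  obtain ⟨β, -, hs⟩ := h.sweep
  obtain ⟨ψ, hψ, hψF⟩ := h.exists_slope
  have hend : ∀ t : unitInterval, X t ∉ Set.Ioo c d → h.curve t = (X t, f (X t)) := by
    intro t ht
    have hx := h.pos_mem t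
    rw [IsLuneSweep.curve, h.front_apply t hx, h.eq_of_notMem hx ht, sub_self, zero_mul, add_zero]
  refine ⟨c, d, h.left, h.lt, h.right, h.support, fun t => ⟨h.curve t, h.curve_mem t⟩, h.front, ψ,
    h.isPeanoCurve, h.continuous_front, hψ, ⟨h.front_zero, h.front_one⟩,
    fun t s hts x hx => h.front_mono hts hx, fun t => rfl, fun t x hx => ?_,
    fun t ht => ⟨h.isLune_front t, h.image_curve ht⟩, ?_, ?_⟩
  · refine ⟨h.front_mem t hx, ?_⟩
    rw [hψF t x hx]
    exact (h.front t).hasDerivWithinAt hx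
  · exact (hend 0 (by rw [hs.pos_zero]; simp)).trans (by rw [hs.pos_zero])
  · exact (hend 1 (by rw [hs.pos_one]; simp)).trans (by rw [hs.pos_one])
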